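/- Let $m\ge 1$ be a squarefree integer, $m\neq 1,3$, let $K=\mathbb{Q}(\sqrt{-m})\subset\mathbb{C}$, let $\mathcal{O}$ be its ring of integers and $h$ its class number. Let $\mathcal{H}=\{(z,\zeta)\in\mathbb{C}\times\mathbb{R}:\zeta>0\}$. A pair $(\mu,\lambda)\in\mathcal{O}^2$ is unimodular if $\mu\mathcal{O}+\lambda\mathcal{O}=\mathcal{O}$; for such a pair with $\mu\ne0$ let $S_{\mu,\lambda}=\{(z,\zeta)\in\mathcal{H}: |\mu z-\lambda|^2+|\mu|^2\zeta^2=1\}$ be the hemisphere with centre $\lambda/\mu$ and radius $1/|\mu|$, also written $S(\lambda/\mu)$. Let $B$ be the set of $(z,\zeta)\in\mathcal{H}$ with $|\mu z-\lambda|^2+|\mu|^2\zeta^2\ge 1$ for all unimodular $(\mu,\lambda)$ with $\mu\neq0$, and let $B(\alpha_1,\dots,\alpha_n)$ be defined by the same inequalities for those pairs only for which $\lambda/\mu\in\alpha_i+\mathcal{O}$ for some $i$. Let $D_0$ be the set of all $x+y\sqrt{-m}$ with $-\frac12\le x\le\frac12$, $0\le y\le\frac12$ if $m\equiv3\bmod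 4$, and with $0\le x,y\le1$ otherwise; let $D_\infty=\{(z,\zeta)\in\mathcal{H}: z\in D_0\}$. The Bianchi fundamental polyhedron is $D=D_\infty\cap B$. Say that $S_{\mu,\lambda}$ is strictly below $S_{\beta,\alpha}$ at $z\in\mathbb{C}$ if $|z-\frac{\alpha}{\beta}|^2-\frac1{|\beta|^2}<|z-\frac{\lambda}{\mu}|^2-\frac1{|\mu|^2}$; that two hemispheres agree at $z$ if neither is strictly below the other at $z$; that they touch if they intersect in $\mathcal{H}$; and that $S_{\mu,\lambda}$ is everywhere below $S_{\beta,\alpha}$ if $|\frac\lambda\mu-\frac\alpha\beta|\le\frac1{|\beta|}-\frac1{|\mu|}$. A point $z\in\mathbb{C}$ is strictly below $S_{\mu,\lambda}$ if $(z,\zeta')\in S_{\mu,\lambda}$ for some $\zeta'>0$. A point $z\in\mathbb C$ is singular if $z=\lambda/\mu$ with $\lambda,\mu\in\mathcal{O}$, $\mu\ne0$, such that the ideal $(\lambda,\mu)$ is not principal, and $(z,0)$ lies in the boundary of $B$. The hemispheres $S(\alpha_1),\dots,S(\alpha_n)$ generate a collection if every non-singular $z\in\mathbb{C}$ is strictly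 below some $S(\alpha_i+\gamma)$, $\gamma\in\mathcal{O}$. Consider the following algorithm, with real variables $N,E$ and a finite list of hemispheres. Initially $N=1$, the list is empty, and $E=\frac{5m}{2}h-2m+\frac12$ if $m\equiv3\bmod4$, $E=21mh-19m$ otherwise. (A) As long as $N\le E$, or the hemispheres in the list do not generate a collection: run, in any order, through the hemispheres $S_{\mu,\lambda}$ with $|\mu|=N$ and $\lambda/\mu\in D_0$, and append each of them to the list unless it is everywhere below a hemisphere already in the list; then replace $N$ by the next greater value of $\mu\mapsto|\mu|$ on $\mathcal{O}$. (B) For each $S$ in the list, consider the sets over which $S$ agrees with $T$, where $T$ runs through the translates by $\mathcal{O}$ of the hemispheres in the list that touch $S$. Take the points which are the unique common point of two of these sets, and drop those at which $S$ is strictly below some translate of a hemisphere in the list. Let $\zeta$ be the lowest positive number such that $(z,\zeta)\in S$ for some $S$ in the list and some remaining point $z$ of $S$. Erase from the list the hemispheres for which no point remains. If $\zeta\ge 1/N$, stop; otherwise put $E:=1/\zeta$ and return to (A). Then: the sets of hemispheres run through in (A), the sets of translates $T$ touching a given $S$ in (B), and the sets of remaining points of a given $S$ are finite; every step can be carried out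 (in particular $\zeta$ in (B) exists); the algorithm stops after finitely many steps; and when it stops, its list $S(\alpha_1),\dots,S(\alpha_n)$ satisfies $B(\alpha_1,\dots,\alpha_n)=B$, so that $B(\alpha_1,\dots,\alpha_n)\cap D_\infty$ is the Bianchi fundamental polyhedron $D$. -/

import Mathlib

open scoped NumberField IntermediateField

noncomputable section

namespace Bianchi

/-- The square root `√-m`, with positive imaginary part. -/
def sqrtNeg (m : ℕ) : ℂ := (Real.sqrt m : ℂ) * Complex.I

theorem sqrtNeg_sq (m : ℕ) : sqrtNeg m ^ 2 = -(m : ℂ) := by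
  have h : ((Real.sqrt m : ℝ) : ℂ) ^ 2 = (m : ℂ) := by
    rw [← Complex.ofReal_pow, Real.sq_sqrt (Nat.cast_nonneg m), Complex.ofReal_natCast]
  rw [sqrtNeg, mul_pow, h, Complex.I_sq]
  ring

/-- The field `K = ℚ(√-m)`, as a subfield of `ℂ`. -/
abbrev QuadField (m : ℕ) : IntermediateField ℚ ℂ := ℚ⟮sqrtNeg m⟯

theorem isIntegral_sqrtNeg (m : ℕ) : IsIntegral ℚ (sqrtNeg m) := by
  refine IsIntegral.of_pow (n := 2) (by norm_num) ?_
  rw [sqrtNeg_sq]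
  have h : IsIntegral ℚ (algebraMap ℚ ℂ (-(m : ℚ))) := isIntegral_algebraMap
  simpa using h

instance instNumberFieldQuadField (m : ℕ) : NumberField (QuadField m) where
  to_charZero := inferInstance
  to_finiteDimensional := IntermediateField.adjoin.finiteDimensional (isIntegral_sqrtNeg m)

/-- The inclusion of the ring of integers of `K` into `ℂ`. -/
def toC {m : ℕ} (a : 𝓞 (QuadField m)) : ℂ := ((a : QuadField m) : ℂ)

/-- A pair `(μ, lam)` is unimodular if `μ𝓞 + lam𝓞 = 𝓞`. -/
def Unimodular {m : ℕ} (μ lam : 𝓞 (QuadField m)) : Prop :=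
  Ideal.span {μ} ⊔ Ideal.span {lam} = ⊤

/-- Upper half-space, as a subset of `ℂ × ℝ`. -/
def upperHalfSpace : Set (ℂ × ℝ) := {p | 0 < p.2}

/-- The data of a hemisphere `S_{μ,lam}`: a unimodular pair with `μ ≠ 0`. -/
structure Hemisphere (m : ℕ) where
  mu : 𝓞 (QuadField m)
  lam : 𝓞 (QuadField m)
  mu_ne_zero : mu ≠ 0
  unimodular : Unimodular mu lam

namespace Hemisphere

variable {m : ℕ}

/-- The centre `lam / μ`. -/
def center (S : Hemisphere m) : ℂ := toC S.lam / toC S.mu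

/-- The radius `1 / |μ|`. -/
def radius (S : Hemisphere m) : ℝ := 1 / ‖toC S.mu‖

/-- The expression `|μ z - lam|² + |μ|² ζ²` at the point `(z, ζ)`. -/
def level (S : Hemisphere m) (p : ℂ × ℝ) : ℝ :=
  ‖toC S.mu * p.1 - toC S.lam‖ ^ 2 + ‖toC S.mu‖ ^ 2 * p.2 ^ 2

/-- The hemisphere as a subset of upper half-space. -/
def surface (S : Hemisphere m) : Set (ℂ × ℝ) := {p | p ∈ upperHalfSpace ∧ S.level p = 1}

/-- `S` is strictly below `T` at the point `z` of the complex plane. -/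
def StrictlyBelowAt (S T : Hemisphere m) (z : ℂ) : Prop :=
  ‖z - T.center‖ ^ 2 - T.radius ^ 2 < ‖z - S.center‖ ^ 2 - S.radius ^ 2

/-- The set over which `S` and `T` agree (a line if the centres differ). -/
def agree (S T : Hemisphere m) : Set ℂ :=
  {z | ¬ S.StrictlyBelowAt T z ∧ ¬ T.StrictlyBelowAt S z}

/-- `S` is everywhere below `T`. -/
def EverywhereBelow (S T : Hemisphere m) : Prop :=
  ‖S.center - T.center‖ ≤ T.radius - S.radius

/-- The two hemispheres touch one another. -/
def Touch (S T : Hemisphere m) : Prop := (S.surface ∩ T.surface).Nonempty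

end Hemisphere

/-- The point `(z, ζ)`, with `ζ ≥ 0`, is strictly below the hemisphere `S`. -/
def PointStrictlyBelow {m : ℕ} (p : ℂ × ℝ) (S : Hemisphere m) : Prop :=
  ∃ ζ' : ℝ, p.2 < ζ' ∧ (p.1, ζ') ∈ S.surface

/-- The set `B` of points above or on all hemispheres. -/
def B (m : ℕ) : Set (ℂ × ℝ) :=
  {p | p ∈ upperHalfSpace ∧ ∀ S : Hemisphere m, 1 ≤ S.level p}

/-- The hemispheres `S(α_i + γ)` with `S(α_i)` in the list `L` and `γ` in the ring of integers. -/
def translates {m : ℕ} (L : List (Hemisphere m)) : Set (Hemisphere m) :=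
  {S | ∃ T ∈ L, ∃ γ : 𝓞 (QuadField m), S.center = T.center + toC γ}

/-- The set `B(α_1, …, α_n)`. -/
def BList {m : ℕ} (L : List (Hemisphere m)) : Set (ℂ × ℝ) :=
  {p | p ∈ upperHalfSpace ∧ ∀ S ∈ translates L, 1 ≤ S.level p}

/-- The fundamental rectangle `D_0` for the translations by the ring of integers. -/
def D0 (m : ℕ) : Set ℂ :=
  if m % 4 = 3 then
    {z | ∃ x y : ℝ, z = x + y * sqrtNeg m ∧ -1 / 2 ≤ x ∧ x ≤ 1 / 2 ∧ 0 ≤ y ∧ y ≤ 1 / 2}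
  else
    {z | ∃ x y : ℝ, z = x + y * sqrtNeg m ∧ 0 ≤ x ∧ x ≤ 1 ∧ 0 ≤ y ∧ y ≤ 1}

/-- The fundamental domain `D_∞` for the translations, in upper half-space. -/
def DInfty (m : ℕ) : Set (ℂ × ℝ) := {p | p ∈ upperHalfSpace ∧ p.1 ∈ D0 m}

/-- The Bianchi fundamental polyhedron. -/
def polyhedron (m : ℕ) : Set (ℂ × ℝ) := DInfty m ∩ B m

/-- Singular points: quotients `lam / μ` with `(lam, μ)` not principal that lie (at height `0`)
on the boundary of `B`. -/
def IsSingularPoint (m : ℕ) (z : ℂ) : Prop :=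
  (∃ μ lam : 𝓞 (QuadField m), μ ≠ 0 ∧ z = toC lam / toC μ ∧
    ¬ (Ideal.span {lam, μ}).IsPrincipal) ∧
  ((z, 0) : ℂ × ℝ) ∈ frontier (B m)

/-- The hemispheres of the list and their translates form a collection: every non-singular point of
the complex plane is strictly below one of them. -/
def IsCollection {m : ℕ} (L : List (Hemisphere m)) : Prop :=
  ∀ z : ℂ, ¬ IsSingularPoint m z → ∃ S ∈ translates L, PointStrictlyBelow (z, 0) S

/-! ### Recording the hemispheres of a given radius -/

/-- The hemispheres of radius `1 / r` with centre in the fundamental rectangle. -/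
def candidates (m : ℕ) (r : ℝ) : Set (Hemisphere m) :=
  {S | ‖toC S.mu‖ = r ∧ S.center ∈ D0 m}

open Classical in
/-- Record `S` into the list, unless it is everywhere below some entry. -/
def recordOne {m : ℕ} (L : List (Hemisphere m)) (S : Hemisphere m) : List (Hemisphere m) :=
  if ∃ T ∈ L, S.EverywhereBelow T then L else L ++ [S]

/-! ### The minimal proper vertex height -/

/-- `z` is an intersection point of two lines referring to `S`, over which `S` agrees with
hemispheres touching it, and `S` is not strictly below any hemisphere at `z`. The other hemispheres
are taken from the list modulo translations. -/
def Remains {m : ℕ} (L : List (Hemisphere m)) (S : Hemisphere m) (z : ℂ) : Prop :=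
  (∃ T₁ ∈ translates L, ∃ T₂ ∈ translates L, S.Touch T₁ ∧ S.Touch T₂ ∧
    S.agree T₁ ∩ S.agree T₂ = {z}) ∧
  ∀ T ∈ translates L, ¬ S.StrictlyBelowAt T z

open Classical in
/-- Erase the hemispheres for which no intersection point remains. -/
def erase {m : ℕ} (L : List (Hemisphere m)) : List (Hemisphere m) :=
  L.filter fun S => decide (∃ z, Remains L S z)

/-- The positive heights of the lifts of the remaining intersection points. -/
def vertexHeights {m : ℕ} (L : List (Hemisphere m)) : Set ℝ :=
  {ζ | 0 < ζ ∧ ∃ S ∈ L, ∃ z, Remains L S z ∧ (z, ζ) ∈ S.surface}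

/-! ### The main algorithm -/

/-- The initial estimate for the highest value of `|μ|`. -/
def initialE (m : ℕ) : ℝ :=
  if m % 4 = 3 then
    5 * (m : ℝ) / 2 * NumberField.classNumber (QuadField m) - 2 * m + 1 / 2
  else
    21 * (m : ℝ) * NumberField.classNumber (QuadField m) - 19 * m

/-- The variables of the algorithm. -/
structure State (m : ℕ) where
  N : ℝ
  E : ℝ
  list : List (Hemisphere m)
  fulfilled : Bool

/-- The initial state: `N = 1`, the initial estimate and the empty list. -/
def initialState (m : ℕ) : State m := ⟨1, initialE m, [], false⟩

/-- The next greater value of `μ ↦ |μ|` on the ring of integers. -/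
def IsNextNorm (m : ℕ) (r r' : ℝ) : Prop :=
  IsLeast {t : ℝ | r < t ∧ ∃ μ : 𝓞 (QuadField m), ‖toC μ‖ = t} r'

/-- The condition of the inner loop: the expected value has not been passed, or the hemispheres do
not yet form a collection (so that the termination criterion does not apply to them). -/
def KeepRecording {m : ℕ} (s : State m) : Prop := s.N ≤ s.E ∨ ¬ IsCollection s.list

/-- One pass of the algorithm through the body of the inner loop, or through the part of the body of
the outer loop that follows the inner loop. The candidates may be run through in any order. -/
inductive Step (m : ℕ) : State m → State m → Prop
  | record (s : State m) (order : List (Hemisphere m)) (N' : ℝ)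
      (running : s.fulfilled = false) (cond : KeepRecording s)
      (complete : ∀ S, S ∈ order ↔ S ∈ candidates m s.N) (next : IsNextNorm m s.N N') :
      Step m s ⟨N', s.E, order.foldl recordOne s.list, false⟩
  | stop_test (s : State m) (ζ : ℝ)
      (running : s.fulfilled = false) (cond : ¬ KeepRecording s)
      (lowest : IsLeast (vertexHeights s.list) ζ) (test : 1 / s.N ≤ ζ) :
      Step m s ⟨s.N, s.E, erase s.list, true⟩
  | continue_test (s : State m) (ζ : ℝ)
      (running : s.fulfilled = false) (cond : ¬ KeepRecording s)
      (lowest : IsLeast (vertexHeights s.list) ζ) (test : ζ < 1 / s.N) :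
      Step m s ⟨s.N, 1 / ζ, erase s.list, false⟩

/-- The states that some run of the algorithm reaches. -/
def Reachable (m : ℕ) (s : State m) : Prop :=
  Relation.ReflTransGen (Step m) (initialState m) s

end Bianchi

end

/-!
The hemispheres are compared through their squared heights `S.val z = r² - ‖z - c‖²`. Differences
of these functions are affine, so the floor of a list of hemispheres and its translates is the
upper envelope of a locally finite family of planes, and its cells are convex polygons. Everything
about the algorithm is expressed by this envelope.

**The floor of `B` needs finitely many hemispheres modulo translation** (`exists_dominatedAt`). A
point outside `K` is strictly below some hemisphere (`exists_val_pos_of_notMem`): a fraction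
`p / q` from Dirichlet's theorem is combined with a unimodular pair whose determinant `x = μ p - lam q`
is small compared to `q`. Every nonzero `x` in the ideal `(p, q)` is such a determinant
(`exists_isCoprime_mul_sub_mul_eq`), and short `x` exist since `𝓞 + 𝓞 z` is not discrete. A
parabolic transformation then moves the pair into place. Hence the points not strictly below any
hemisphere are the singular points. Near a singular point `p / q`, the hemispheres
`S_{t q², t p q - 1}` pass through it in all directions and dominate the small hemispheres; elsewhere domination
of small hemispheres is clear, and compactness of the fundamental rectangle gives a uniform bound.

**Erasing is harmless** (`IsCollection.exists_erase_val_ge`). By Baire's theorem the cells with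
interior points cover the plane, so it suffices that such a cell has a remaining point
(`IsCollection.exists_remains`). Take an extreme point. If its height is positive, two hemispheres
on top there have centres not collinear with that of `S`, as otherwise the point could be moved
inside the cell in two opposite directions. If it is a singular point on the boundary circle of
`S`, there are hemispheres on top rising above `S` in the two tangent directions; these touch `S`
and cut out the point.

**Correctness** (`IsCollection.exists_val_ge`). Suppose that a hemisphere with `|μ| ≥ N` rises
above the envelope of a collection. An extreme point of the set where the excess is maximal is
again a vertex, of positive height and lower than `1 / N`, contrary to the criterion.

**Progress and termination.** The unit hemisphere at the origin stays in the list, and the segment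
where it agrees with its translate by `1` ends in a vertex of positive height, because the sixth
roots of unity are not in `K` (`IsCollection.nonempty_vertexHeights`). In an infinite run `N` is
unbounded; once it exceeds the bound for the floor of `B`, the list is a collection and the
vertices come from a finite set modulo translation, so their positive heights are bounded below
(`exists_le_height`), `E` stays bounded, and the criterion is eventually fulfilled.
-/

namespace Bianchi

/-! ### The ring of integers as a lattice in the complex plane -/

section Ring

variable {m : ℕ}

/-- The inclusion of the ring of integers into `ℂ`, as a ring homomorphism. -/
noncomputable def toCHom (m : ℕ) : 𝓞 (QuadField m) →+* ℂ :=
  (algebraMap (QuadField m) ℂ).comp (algebraMap (𝓞 (QuadField m)) (QuadField m))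

theorem toC_add (a b : 𝓞 (QuadField m)) : toC (a + b) = toC a + toC b := map_add (toCHom m) a b
theorem toC_sub (a b : 𝓞 (QuadField m)) : toC (a - b) = toC a - toC b := map_sub (toCHom m) a b
theorem toC_mul (a b : 𝓞 (QuadField m)) : toC (a * b) = toC a * toC b := map_mul (toCHom m) a b
theorem toC_neg (a : 𝓞 (QuadField m)) : toC (-a) = -toC a := map_neg (toCHom m) a
theorem toC_one : toC (1 : 𝓞 (QuadField m)) = 1 := map_one (toCHom m)
theorem toC_zero : toC (0 : 𝓞 (QuadField m)) = 0 := map_zero (toCHom m)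
theorem toC_intCast (n : ℤ) : toC (n : 𝓞 (QuadField m)) = n := map_intCast (toCHom m) n

theorem toC_injective : Function.Injective (toC : 𝓞 (QuadField m) → ℂ) := fun _ _ h =>
  NumberField.RingOfIntegers.ext (Subtype.ext h)

theorem toC_eq_zero_iff (a : 𝓞 (QuadField m)) : toC a = 0 ↔ a = 0 := by
  rw [← toC_zero, toC_injective.eq_iff]

theorem toC_mem (a : 𝓞 (QuadField m)) : toC a ∈ QuadField m := SetLike.coe_mem _

theorem isIntegral_toC (a : 𝓞 (QuadField m)) : IsIntegral ℤ (toC a) :=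
  map_isIntegral_int (algebraMap (QuadField m) ℂ) a.2

theorem exists_toC_eq {z : ℂ} (hz : z ∈ QuadField m) (hi : IsIntegral ℤ z) :
    ∃ a : 𝓞 (QuadField m), toC a = z := by
  have h : IsIntegral ℤ (⟨z, hz⟩ : QuadField m) :=
    (isIntegral_algebraMap_iff (algebraMap (QuadField m) ℂ).injective).1 hi
  exact ⟨⟨⟨z, hz⟩, h⟩, rfl⟩

theorem sqrtNeg_mem (m : ℕ) : sqrtNeg m ∈ QuadField m :=
  IntermediateField.mem_adjoin_simple_self ℚ _

theorem sqrtNeg_re (m : ℕ) : (sqrtNeg m).re = 0 := by simp [sqrtNeg]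
theorem sqrtNeg_im (m : ℕ) : (sqrtNeg m).im = √m := by simp [sqrtNeg]

theorem norm_sqrtNeg (m : ℕ) : ‖sqrtNeg m‖ = √m := by
  simp [sqrtNeg, abs_of_nonneg (Real.sqrt_nonneg _)]

theorem exists_rat_of_mem {z : ℂ} (hz : z ∈ QuadField m) :
    ∃ x y : ℚ, z = x + y * sqrtNeg m := by
  rw [← IntermediateField.mem_toSubalgebra,
    IntermediateField.adjoin_simple_toSubalgebra_of_isAlgebraic
      (isIntegral_sqrtNeg m).isAlgebraic] at hz
  induction hz using Algebra.adjoin_induction with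
  | mem x hx => exact ⟨0, 1, by rw [Set.mem_singleton_iff.1 hx]; simp⟩
  | algebraMap r => exact ⟨r, 0, by simp⟩
  | add a b _ _ ha hb =>
    obtain ⟨x, y, rfl⟩ := ha
    obtain ⟨x', y', rfl⟩ := hb
    exact ⟨x + x', y + y', by push_cast; ring⟩
  | mul a b _ _ ha hb =>
    obtain ⟨x, y, rfl⟩ := ha
    obtain ⟨x', y', rfl⟩ := hb
    refine ⟨x * x' - m * y * y', x * y' + y * x', ?_⟩
    push_cast
    linear_combination (y * y' : ℂ) * sqrtNeg_sq m

theorem exists_div_of_mem {z : ℂ} (hz : z ∈ QuadField m) :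
    ∃ p q : 𝓞 (QuadField m), q ≠ 0 ∧ z = toC p / toC q := by
  obtain ⟨p, q, hq, h⟩ :=
    IsFractionRing.div_surjective (A := 𝓞 (QuadField m)) (⟨z, hz⟩ : QuadField m)
  refine ⟨p, q, nonZeroDivisors.ne_zero hq, ?_⟩
  have := congrArg (algebraMap (QuadField m) ℂ) h
  rw [map_div₀] at this
  exact this.symm

theorem exists_int_of_isIntegral_rat {r : ℚ} (h : IsIntegral ℤ (r : ℂ)) : ∃ n : ℤ, r = n := by
  have h' : IsIntegral ℤ (algebraMap ℚ ℂ r) := by simpa using h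
  have := (isIntegral_algebraMap_iff (algebraMap ℚ ℂ).injective).1 h'
  obtain ⟨n, hn⟩ := IsIntegrallyClosed.isIntegral_iff.1 this
  exact ⟨n, by simpa using hn.symm⟩

/-- Twice the real part (the trace) and the squared absolute value (the norm) of an algebraic
integer of `K` are integers. -/
theorem exists_int_trace_norm (a : 𝓞 (QuadField m)) :
    (∃ k : ℤ, 2 * (toC a).re = k) ∧ ∃ n : ℤ, ‖toC a‖ ^ 2 = n := by
  obtain ⟨x, y, h⟩ := exists_rat_of_mem (toC_mem a)
  have hi := isIntegral_toC a
  have hc : IsIntegral ℤ ((starRingEnd ℂ) (toC a)) := map_isIntegral_int (starRingEnd ℂ) hi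
  have hre : (toC a).re = x := by rw [h]; simp [sqrtNeg_re]
  have him : (toC a).im = y * √m := by rw [h]; simp [sqrtNeg_im]
  have hn : ‖toC a‖ ^ 2 = ((x ^ 2 + m * y ^ 2 : ℚ) : ℝ) := by
    rw [← Complex.normSq_eq_norm_sq, Complex.normSq_apply, hre, him]
    push_cast
    have := Real.mul_self_sqrt (Nat.cast_nonneg (α := ℝ) m)
    linear_combination (y : ℝ) ^ 2 * this
  constructor
  · have h2 : IsIntegral ℤ (((2 * x : ℚ)) : ℂ) := by
      have := hi.add hc
      rw [Complex.add_conj, hre] at this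
      simpa using this
    obtain ⟨k, hk⟩ := exists_int_of_isIntegral_rat h2
    refine ⟨k, ?_⟩
    rw [hre]
    exact_mod_cast hk
  · have h2 : IsIntegral ℤ (((x ^ 2 + m * y ^ 2 : ℚ)) : ℂ) := by
      have := hi.mul hc
      rw [Complex.mul_conj, Complex.normSq_eq_norm_sq, hn] at this
      simpa using this
    obtain ⟨k, hk⟩ := exists_int_of_isIntegral_rat h2
    refine ⟨k, ?_⟩
    rw [hn]
    exact_mod_cast hk

theorem one_le_norm_toC {a : 𝓞 (QuadField m)} (ha : a ≠ 0) : 1 ≤ ‖toC a‖ := by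
  obtain ⟨n, hn⟩ := (exists_int_trace_norm a).2
  have hpos : 0 < ‖toC a‖ := norm_pos_iff.2 (mt (toC_eq_zero_iff a).1 ha)
  have h0 : (0 : ℝ) < n := hn ▸ pow_pos hpos 2
  have h1 : (1 : ℝ) ≤ n := by exact_mod_cast (by exact_mod_cast h0 : (0 : ℤ) < n)
  nlinarith

theorem norm_sq_add_one_le {a b : 𝓞 (QuadField m)} (h : ‖toC a‖ < ‖toC b‖) :
    ‖toC a‖ ^ 2 + 1 ≤ ‖toC b‖ ^ 2 := by
  obtain ⟨n, hn⟩ := (exists_int_trace_norm a).2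
  obtain ⟨k, hk⟩ := (exists_int_trace_norm b).2
  have h2 : ‖toC a‖ ^ 2 < ‖toC b‖ ^ 2 := pow_lt_pow_left₀ h (norm_nonneg _) two_ne_zero
  rw [hn, hk] at h2 ⊢
  exact_mod_cast (by exact_mod_cast h2 : n < k)

theorem norm_toC_of_isUnit {a : 𝓞 (QuadField m)} (ha : IsUnit a) : ‖toC a‖ = 1 := by
  obtain ⟨b, hb⟩ := ha.exists_right_inv
  have hb0 : b ≠ 0 := by rintro rfl; simp at hb
  have h : ‖toC a‖ * ‖toC b‖ = 1 := by rw [← norm_mul, ← toC_mul, hb, toC_one, norm_one]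
  have h1 := one_le_norm_toC ha.ne_zero
  have h2 := one_le_norm_toC hb0
  nlinarith

/-- The ring of integers is discrete in `ℂ`. -/
theorem finite_norm_le (m : ℕ) (R : ℝ) : {a : 𝓞 (QuadField m) | ‖toC a‖ ≤ R}.Finite := by
  -- An integer is determined by its trace, its norm and the sign of its imaginary part.
  let g : ℤ × ℤ × ℤ → ℂ := fun t =>
    ⟨t.1 / 2, t.2.2 * √(t.2.1 - (t.1 / 2 : ℝ) ^ 2)⟩
  have hfin : (g '' (Set.Icc (-⌈2 * R⌉) ⌈2 * R⌉ ×ˢ (Set.Icc 0 ⌈R ^ 2⌉ ×ˢ Set.Icc (-1) 1))).Finite :=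
    (((Set.finite_Icc _ _).prod ((Set.finite_Icc _ _).prod (Set.finite_Icc _ _)))).image _
  refine (hfin.preimage toC_injective.injOn).subset fun a ha => ?_
  obtain ⟨⟨k, hk⟩, n, hn⟩ := exists_int_trace_norm a
  have ha' : ‖toC a‖ ≤ R := ha
  have hre := abs_le.1 ((Complex.abs_re_le_norm (toC a)).trans ha')
  have him : (toC a).im ^ 2 = n - ((k : ℝ) / 2) ^ 2 := by
    rw [← hn, ← Complex.normSq_eq_norm_sq, Complex.normSq_apply, ← hk]; ring
  have hsq : √(n - ((k : ℝ) / 2) ^ 2) = |(toC a).im| := by rw [← him, Real.sqrt_sq_eq_abs]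
  have hkb : k ∈ Set.Icc (-⌈2 * R⌉) ⌈2 * R⌉ := by
    have h1 : (k : ℝ) ≤ ⌈2 * R⌉ := by rw [← hk]; linarith [Int.le_ceil (2 * R)]
    have h2 : -(⌈2 * R⌉ : ℝ) ≤ k := by rw [← hk]; linarith [Int.le_ceil (2 * R)]
    exact ⟨by exact_mod_cast h2, by exact_mod_cast h1⟩
  have hnb : n ∈ Set.Icc 0 ⌈R ^ 2⌉ := by
    have h1 : (0 : ℝ) ≤ n := hn ▸ sq_nonneg _
    have h2 : (n : ℝ) ≤ ⌈R ^ 2⌉ := by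
      rw [← hn]; exact (pow_le_pow_left₀ (norm_nonneg _) ha' 2).trans (Int.le_ceil _)
    exact ⟨by exact_mod_cast h1, by exact_mod_cast h2⟩
  rcases le_total 0 (toC a).im with h | h
  · refine ⟨(k, n, 1), ⟨hkb, hnb, by norm_num⟩, ?_⟩
    apply Complex.ext
    · simp [g]; linarith
    · simp [g, hsq, abs_of_nonneg h]
  · refine ⟨(k, n, -1), ⟨hkb, hnb, by norm_num⟩, ?_⟩
    apply Complex.ext
    · simp [g]; linarith
    · simp [g, hsq, abs_of_nonpos h]

theorem countable_integers (m : ℕ) : Countable (𝓞 (QuadField m)) := by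
  rw [← Set.countable_univ_iff]
  have : (Set.univ : Set (𝓞 (QuadField m))) = ⋃ n : ℕ, {a | ‖toC a‖ ≤ n} := by
    ext a
    simpa using exists_nat_ge ‖toC a‖
  rw [this]
  exact Set.countable_iUnion fun n => (finite_norm_le m n).countable

theorem countable_quadField (m : ℕ) : {z : ℂ | z ∈ QuadField m}.Countable := by
  have h : {z : ℂ | z ∈ QuadField m} ⊆
      Set.range fun t : ℚ × ℚ => (t.1 + t.2 * sqrtNeg m : ℂ) := fun z hz => by
    obtain ⟨x, y, h⟩ := exists_rat_of_mem hz
    exact ⟨(x, y), h.symm⟩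
  exact (Set.countable_range _).mono h

theorem dense_compl_quadField (m : ℕ) : Dense {z : ℂ | z ∉ QuadField m} :=
  (countable_quadField m).dense_compl ℝ

theorem exists_toC_eq_sqrtNeg (m : ℕ) : ∃ a : 𝓞 (QuadField m), toC a = sqrtNeg m := by
  refine exists_toC_eq (sqrtNeg_mem m) (IsIntegral.of_pow (n := 2) (by norm_num) ?_)
  rw [sqrtNeg_sq]
  have h : IsIntegral ℤ (algebraMap ℤ ℂ (-(m : ℤ))) := isIntegral_algebraMap
  simpa using h

theorem exists_toC_eq_half (hm : m % 4 = 3) :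
    ∃ a : 𝓞 (QuadField m), toC a = (1 + sqrtNeg m) / 2 := by
  have hmem : (1 + sqrtNeg m) / 2 ∈ QuadField m :=
    div_mem (add_mem (one_mem _) (sqrtNeg_mem m)) (ofNat_mem _ 2)
  refine exists_toC_eq hmem ?_
  obtain ⟨k, hk⟩ : ∃ k : ℕ, m + 1 = 4 * k := ⟨(m + 1) / 4, by omega⟩
  have hk' : (m : ℂ) + 1 = 4 * k := by exact_mod_cast hk
  -- `(1 + √-m) / 2` is a root of `X² - X + (m + 1) / 4`.
  refine ⟨Polynomial.X ^ 2 - Polynomial.X + Polynomial.C (k : ℤ), ?_, ?_⟩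
  · monicity!
  · simp only [Polynomial.eval₂_add, Polynomial.eval₂_sub,
      Polynomial.eval₂_X_pow, Polynomial.eval₂_X, Polynomial.eval₂_natCast, map_natCast]
    linear_combination sqrtNeg_sq m / 4 - hk' / 4

/-- Every complex number lies in a lattice translate of the rectangle `D_0`. -/
theorem exists_sub_mem_D0 (hm : m ≠ 0) (z : ℂ) : ∃ γ : 𝓞 (QuadField m), z - toC γ ∈ D0 m := by
  have hs : 0 < √(m : ℝ) := Real.sqrt_pos.2 (by exact_mod_cast Nat.pos_of_ne_zero hm)
  by_cases h4 : m % 4 = 3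
  · obtain ⟨ω, hω⟩ := exists_toC_eq_half h4
    set b := ⌊2 * z.im / √(m : ℝ)⌋ with hb
    set a := round (z.re - b / 2) with ha
    refine ⟨(a : 𝓞 (QuadField m)) + (b : 𝓞 (QuadField m)) * ω, ?_⟩
    rw [D0, if_pos h4]
    have h1 := Int.floor_le (2 * z.im / √(m : ℝ))
    have h2 := (Int.lt_floor_add_one (2 * z.im / √(m : ℝ))).le
    have h3 := abs_le.1 (abs_sub_round (z.re - (b : ℝ) / 2))
    rw [← hb] at h1 h2
    rw [← ha] at h3
    refine ⟨z.re - b / 2 - a, z.im / √m - b / 2, ?_, by linarith, by linarith, ?_, ?_⟩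
    · rw [toC_add, toC_mul, toC_intCast, toC_intCast, hω]
      apply Complex.ext
      · simp [sqrtNeg_re]; ring
      · simp [sqrtNeg_im]; field_simp
    · rw [mul_div_assoc] at h1; linarith
    · rw [mul_div_assoc] at h2; linarith
  · obtain ⟨ω, hω⟩ := exists_toC_eq_sqrtNeg m
    refine ⟨(⌊z.re⌋ : 𝓞 (QuadField m)) + (⌊z.im / √(m : ℝ)⌋ : 𝓞 (QuadField m)) * ω, ?_⟩
    rw [D0, if_neg h4]
    refine ⟨Int.fract z.re, Int.fract (z.im / √m), ?_, Int.fract_nonneg _,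
      (Int.fract_lt_one _).le, Int.fract_nonneg _, (Int.fract_lt_one _).le⟩
    rw [toC_add, toC_mul, toC_intCast, toC_intCast, hω]
    apply Complex.ext
    · simp [sqrtNeg_re, ← Int.self_sub_floor]
    · simp only [Complex.sub_im, Complex.add_im, Complex.intCast_im, Complex.mul_im,
        Complex.intCast_re, sqrtNeg_im, sqrtNeg_re, Complex.ofReal_im, Complex.ofReal_re,
        ← Int.self_sub_floor]
      field_simp
      ring

theorem norm_le_of_mem_D0 {z : ℂ} (hz : z ∈ D0 m) : ‖z‖ ≤ 1 + √m := by
  have key : ∀ x y : ℝ, |x| ≤ 1 → |y| ≤ 1 → ‖(x + y * sqrtNeg m : ℂ)‖ ≤ 1 + √m := by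
    intro x y hx hy
    refine (norm_add_le _ _).trans ?_
    rw [norm_mul, norm_sqrtNeg, Complex.norm_real, Complex.norm_real, Real.norm_eq_abs,
      Real.norm_eq_abs]
    nlinarith [Real.sqrt_nonneg (m : ℝ)]
  rw [D0] at hz
  split_ifs at hz
  · obtain ⟨x, y, rfl, h1, h2, h3, h4⟩ := hz
    exact key x y (abs_le.2 ⟨by linarith, by linarith⟩) (abs_le.2 ⟨by linarith, by linarith⟩)
  · obtain ⟨x, y, rfl, h1, h2, h3, h4⟩ := hz
    exact key x y (abs_le.2 ⟨by linarith, by linarith⟩) (abs_le.2 ⟨by linarith, by linarith⟩)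

/-- The covering radius of the lattice is at most `1 + √m`. -/
theorem exists_norm_sub_le (hm : m ≠ 0) (z : ℂ) :
    ∃ γ : 𝓞 (QuadField m), ‖z - toC γ‖ ≤ 1 + √m :=
  (exists_sub_mem_D0 hm z).imp fun _ h => norm_le_of_mem_D0 h

theorem exists_isNextNorm (m : ℕ) (r : ℝ) : ∃ r', IsNextNorm m r r' := by
  obtain ⟨n, hn⟩ := exists_nat_gt r
  have hn' : ‖toC ((n : ℤ) : 𝓞 (QuadField m))‖ = n := by rw [toC_intCast]; simp
  set T : Set ℝ := {t | r < t ∧ ∃ μ : 𝓞 (QuadField m), ‖toC μ‖ = t}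
  have hfin : (T ∩ Set.Iic (n : ℝ)).Finite := by
    refine ((finite_norm_le m n).image fun a => ‖toC a‖).subset ?_
    rintro t ⟨⟨-, μ, rfl⟩, h⟩
    exact ⟨μ, h, rfl⟩
  have hmem : (n : ℝ) ∈ T ∩ Set.Iic (n : ℝ) := ⟨⟨hn, _, hn'⟩, Set.self_mem_Iic⟩
  obtain ⟨t, ht, hmin⟩ := Set.exists_min_image _ id hfin ⟨_, hmem⟩
  refine ⟨t, ht.1, fun t' ht' => ?_⟩
  rcases le_total t' n with h | h
  · exact hmin t' ⟨ht', h⟩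
  · exact (hmin _ hmem).trans h

/-- The sixth roots of unity are not in `K`. -/
theorem notMem_quadField_of_norm_eq_one (hm : Squarefree m) (hm3 : m ≠ 3) {z : ℂ}
    (hre : z.re = 1 / 2) (hz : ‖z‖ = 1) : z ∉ QuadField m := by
  intro h
  obtain ⟨x, y, hxy⟩ := exists_rat_of_mem h
  have him : z.im = y * √m := by rw [hxy]; simp [sqrtNeg_im]
  have h1 : z.re * z.re + z.im * z.im = 1 := by
    rw [← Complex.normSq_apply, Complex.normSq_eq_norm_sq, hz]; norm_num
  have h2 : (y : ℝ) ^ 2 * m * 4 = 3 := by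
    rw [hre, him] at h1
    have := Real.mul_self_sqrt (Nat.cast_nonneg (α := ℝ) m)
    linear_combination 4 * h1 - 4 * (y : ℝ) ^ 2 * this
  have h3 : (2 * m * y) ^ 2 = ((3 * m : ℕ) : ℚ) := by
    have : y ^ 2 * m * 4 = 3 := by exact_mod_cast h2
    push_cast
    linear_combination (m : ℚ) * this
  -- `3 m` is the square of a rational number, hence of an integer.
  obtain ⟨k, hk⟩ : IsSquare (3 * m) := Rat.isSquare_natCast_iff.1 ⟨_, by rw [← h3, sq]⟩
  have h3k : 3 ∣ k := by
    have : 3 ∣ k * k := ⟨m, hk.symm⟩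
    exact (Nat.Prime.dvd_mul Nat.prime_three).1 this |>.elim id id
  obtain ⟨j, rfl⟩ := h3k
  have hmj : m = j * j * 3 := by linarith
  have hj : j = 1 := Nat.isUnit_iff.1 (hm j ⟨3, hmj⟩)
  exact hm3 (by rw [hmj, hj])

end Ring

/-! ### Hemispheres and their squared heights -/

variable {m : ℕ}

theorem unimodular_of_isCoprime {a b : 𝓞 (QuadField m)} (h : IsCoprime a b) : Unimodular a b :=
  Ideal.isCoprime_iff_sup_eq.1 ((Ideal.isCoprime_span_singleton_iff _ _).2 h)

namespace Hemisphere

theorem isCoprime (S : Hemisphere m) : IsCoprime S.mu S.lam :=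
  (Ideal.isCoprime_span_singleton_iff _ _).1 (Ideal.isCoprime_iff_sup_eq.2 S.unimodular)

/-- The squared height of the hemisphere above the point `z`, negative where the hemisphere does not
lie above `z`. Differences of such functions are affine, so that the maximum over a family of
hemispheres is an upper envelope of planes, up to the summand `-‖z‖²`. -/
noncomputable def val (S : Hemisphere m) (z : ℂ) : ℝ := S.radius ^ 2 - ‖z - S.center‖ ^ 2

theorem strictlyBelowAt_iff {S T : Hemisphere m} {z : ℂ} :
    S.StrictlyBelowAt T z ↔ S.val z < T.val z := by
  unfold StrictlyBelowAt val
  constructor <;> intro h <;> linarith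

theorem mem_agree_iff {S T : Hemisphere m} {z : ℂ} : z ∈ S.agree T ↔ S.val z = T.val z := by
  simp only [agree, Set.mem_ofPred_eq, strictlyBelowAt_iff, not_lt]
  exact ⟨fun h => le_antisymm h.2 h.1, fun h => ⟨h.ge, h.le⟩⟩

theorem toC_mu_ne_zero (S : Hemisphere m) : toC S.mu ≠ 0 :=
  mt (toC_eq_zero_iff _).1 S.mu_ne_zero

theorem one_le_norm_mu (S : Hemisphere m) : 1 ≤ ‖toC S.mu‖ := one_le_norm_toC S.mu_ne_zero

theorem radius_pos (S : Hemisphere m) : 0 < S.radius :=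
  one_div_pos.2 (norm_pos_iff.2 S.toC_mu_ne_zero)

theorem radius_le_one (S : Hemisphere m) : S.radius ≤ 1 :=
  (div_le_one (norm_pos_iff.2 S.toC_mu_ne_zero)).2 S.one_le_norm_mu

theorem radius_mul_norm_mu (S : Hemisphere m) : S.radius * ‖toC S.mu‖ = 1 :=
  one_div_mul_cancel (norm_ne_zero_iff.2 S.toC_mu_ne_zero)

theorem norm_mul_sub (S : Hemisphere m) (z : ℂ) :
    ‖toC S.mu * z - toC S.lam‖ = ‖toC S.mu‖ * ‖z - S.center‖ := by
  rw [← norm_mul, center, mul_sub, mul_div_cancel₀ _ S.toC_mu_ne_zero]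

theorem level_eq (S : Hemisphere m) (p : ℂ × ℝ) :
    S.level p = 1 + ‖toC S.mu‖ ^ 2 * (p.2 ^ 2 - S.val p.1) := by
  rw [level, norm_mul_sub, val]
  linear_combination (S.radius * ‖toC S.mu‖ + 1) * S.radius_mul_norm_mu

theorem one_le_level_iff {S : Hemisphere m} {p : ℂ × ℝ} :
    1 ≤ S.level p ↔ S.val p.1 ≤ p.2 ^ 2 := by
  have h : 0 < ‖toC S.mu‖ ^ 2 := pow_pos (norm_pos_iff.2 S.toC_mu_ne_zero) 2
  rw [level_eq, le_add_iff_nonneg_right, mul_nonneg_iff_of_pos_left h, sub_nonneg]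

theorem mem_surface_iff {S : Hemisphere m} {p : ℂ × ℝ} :
    p ∈ S.surface ↔ 0 < p.2 ∧ S.val p.1 = p.2 ^ 2 := by
  have h : ‖toC S.mu‖ ^ 2 ≠ 0 := pow_ne_zero 2 (norm_ne_zero_iff.2 S.toC_mu_ne_zero)
  simp only [surface, upperHalfSpace, Set.mem_ofPred_eq, level_eq, add_eq_left, mul_eq_zero, h,
    false_or, sub_eq_zero]
  exact and_congr_right fun _ => eq_comm

theorem touch_of_val_eq {S T : Hemisphere m} {z : ℂ} (h0 : 0 < S.val z) (h : S.val z = T.val z) :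
    S.Touch T := by
  refine ⟨(z, √(S.val z)), mem_surface_iff.2 ⟨Real.sqrt_pos.2 h0, ?_⟩,
    mem_surface_iff.2 ⟨Real.sqrt_pos.2 h0, ?_⟩⟩
  · rw [Real.sq_sqrt h0.le]
  · rw [Real.sq_sqrt h0.le, h]

theorem Touch.exists_val {S T : Hemisphere m} (h : S.Touch T) :
    ∃ z, 0 < S.val z ∧ S.val z = T.val z := by
  obtain ⟨p, hS, hT⟩ := h
  rw [mem_surface_iff] at hS hT
  exact ⟨p.1, hS.2 ▸ pow_pos hS.1 2, hS.2.trans hT.2.symm⟩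

theorem val_le_radius_sq (S : Hemisphere m) (z : ℂ) : S.val z ≤ S.radius ^ 2 := by
  unfold val; linarith [sq_nonneg ‖z - S.center‖]

theorem val_le_one (S : Hemisphere m) (z : ℂ) : S.val z ≤ 1 :=
  (S.val_le_radius_sq z).trans (pow_le_one₀ S.radius_pos.le S.radius_le_one)

theorem norm_sub_center_le {S : Hemisphere m} {z : ℂ} (h : 0 ≤ S.val z) :
    ‖z - S.center‖ ≤ 1 := by
  have h1 : ‖z - S.center‖ ^ 2 ≤ 1 ^ 2 := by
    have := pow_le_one₀ (n := 2) S.radius_pos.le S.radius_le_one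
    unfold val at h
    linarith
  exact le_of_sq_le_sq h1 zero_le_one

theorem continuous_val (S : Hemisphere m) : Continuous S.val := by
  unfold val; fun_prop

/-- The expansion of the squared height around a point. -/
theorem val_add (S : Hemisphere m) (v w : ℂ) :
    S.val (v + w) = S.val v + 2 * inner ℝ (S.center - v) w - ‖w‖ ^ 2 := by
  unfold val
  have h := norm_sub_sq_real w (S.center - v)
  rw [show v + w - S.center = w - (S.center - v) by ring, h, norm_sub_rev v, real_inner_comm]
  ring

theorem val_smul (S : Hemisphere m) (v d : ℂ) (t : ℝ) :
    S.val (v + t • d) = S.val v + 2 * t * inner ℝ (S.center - v) d - t ^ 2 * ‖d‖ ^ 2 := by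
  rw [val_add, inner_smul_right, norm_smul, mul_pow, Real.norm_eq_abs, sq_abs]
  ring

/-- Differences of squared heights are affine functions. -/
theorem val_sub_val_smul (S T : Hemisphere m) (v d : ℂ) (t : ℝ) :
    T.val (v + t • d) - S.val (v + t • d) =
      T.val v - S.val v + 2 * t * inner ℝ (T.center - S.center) d := by
  rw [val_smul, val_smul, show T.center - S.center = (T.center - v) - (S.center - v) by ring,
    inner_sub_left (T.center - v)]
  ring

/-- Hemispheres with centres in one class modulo the lattice have the same radius. -/
theorem radius_eq_of_center_eq {S T : Hemisphere m} {γ : 𝓞 (QuadField m)}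
    (h : S.center = T.center + toC γ) : S.radius = T.radius := by
  have h1 : S.lam * T.mu = (T.lam + γ * T.mu) * S.mu := by
    apply toC_injective
    have hS := S.toC_mu_ne_zero
    have hT := T.toC_mu_ne_zero
    unfold center at h
    simp only [toC_mul, toC_add]
    field_simp at h
    linear_combination h
  have hT : IsCoprime T.mu (T.lam + γ * T.mu) := T.isCoprime.add_mul_right_right γ
  have hdvd : S.mu ∣ T.mu := S.isCoprime.dvd_of_dvd_mul_left ⟨_, h1.trans (mul_comm _ _)⟩
  have hdvd' : T.mu ∣ S.mu := hT.dvd_of_dvd_mul_left ⟨_, h1.symm.trans (mul_comm _ _)⟩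
  obtain ⟨u, hu⟩ := associated_of_dvd_dvd hdvd hdvd'
  rw [radius, radius, ← hu, toC_mul, norm_mul, norm_toC_of_isUnit u.isUnit, mul_one]

theorem norm_mu_eq_of_center_eq {S T : Hemisphere m} {γ : 𝓞 (QuadField m)}
    (h : S.center = T.center + toC γ) : ‖toC S.mu‖ = ‖toC T.mu‖ := by
  have := radius_eq_of_center_eq h
  rw [radius, radius, one_div, one_div] at this
  exact inv_injective this

theorem val_add_eq {S T : Hemisphere m} {γ : 𝓞 (QuadField m)}
    (h : S.center = T.center + toC γ) (z : ℂ) : S.val (z + toC γ) = T.val z := by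
  rw [val, val, radius_eq_of_center_eq h, h, add_sub_add_right_eq_sub]

/-- The translate of a hemisphere by a lattice element. -/
noncomputable def shift (S : Hemisphere m) (γ : 𝓞 (QuadField m)) : Hemisphere m where
  mu := S.mu
  lam := S.lam + γ * S.mu
  mu_ne_zero := S.mu_ne_zero
  unimodular := unimodular_of_isCoprime (S.isCoprime.add_mul_right_right γ)

theorem center_shift (S : Hemisphere m) (γ : 𝓞 (QuadField m)) :
    (S.shift γ).center = S.center + toC γ := by
  have := S.toC_mu_ne_zero
  simp only [center, shift, toC_add, toC_mul]
  field_simp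

theorem val_shift (S : Hemisphere m) (γ : 𝓞 (QuadField m)) (z : ℂ) :
    (S.shift γ).val (z + toC γ) = S.val z := val_add_eq (S.center_shift γ) z

theorem EverywhereBelow.val_le {S T : Hemisphere m} (h : S.EverywhereBelow T) {z : ℂ}
    (hz : 0 ≤ S.val z) : S.val z ≤ T.val z := by
  unfold EverywhereBelow at h
  unfold val at hz ⊢
  have h1 : ‖z - T.center‖ ≤ ‖z - S.center‖ + ‖S.center - T.center‖ :=
    norm_sub_le_norm_sub_add_norm_sub ..
  have h2 : ‖z - S.center‖ ≤ S.radius := le_of_sq_le_sq (by linarith) S.radius_pos.le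
  have h3 := norm_nonneg (z - T.center)
  have h4 := norm_nonneg (z - S.center)
  have h5 := S.radius_pos
  have h6 := norm_nonneg (S.center - T.center)
  nlinarith

theorem finite_norm_mu_center_le (m : ℕ) (R R' : ℝ) :
    {S : Hemisphere m | ‖toC S.mu‖ ≤ R ∧ ‖S.center‖ ≤ R'}.Finite := by
  have hinj : Function.Injective fun S : Hemisphere m => (S.mu, S.lam) := by
    rintro ⟨a, b, _, _⟩ ⟨c, d, _, _⟩ h
    simpa using h
  refine (((finite_norm_le m R).prod (finite_norm_le m (R' * R))).preimage hinj.injOn).subset ?_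
  rintro S ⟨h1, h2⟩
  refine ⟨h1, ?_⟩
  have h3 : toC S.lam = S.center * toC S.mu := (div_mul_cancel₀ _ S.toC_mu_ne_zero).symm
  show ‖toC S.lam‖ ≤ R' * R
  rw [h3, norm_mul]
  exact mul_le_mul h2 h1 (norm_nonneg _) ((norm_nonneg _).trans h2)

theorem countable_hemisphere (m : ℕ) : Countable (Hemisphere m) := by
  have := countable_integers m
  have hinj : Function.Injective fun S : Hemisphere m => (S.mu, S.lam) := by
    rintro ⟨a, b, _, _⟩ ⟨c, d, _, _⟩ h
    simpa using h
  exact hinj.countable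

end Hemisphere

theorem pointStrictlyBelow_iff {S : Hemisphere m} {z : ℂ} :
    PointStrictlyBelow (z, 0) S ↔ 0 < S.val z := by
  simp only [PointStrictlyBelow, Hemisphere.mem_surface_iff]
  constructor
  · rintro ⟨ζ, -, h0, h⟩
    rw [h]
    exact pow_pos h0 2
  · intro h
    exact ⟨√(S.val z), Real.sqrt_pos.2 h, Real.sqrt_pos.2 h, (Real.sq_sqrt h.le).symm⟩

theorem finite_candidates (m : ℕ) (r : ℝ) : (candidates m r).Finite :=
  (Hemisphere.finite_norm_mu_center_le m r (1 + √m)).subset fun _ h =>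
    ⟨h.1.le, norm_le_of_mem_D0 h.2⟩

/-! ### Translates of a finite list of hemispheres -/

theorem mem_translates_of_mem {L : List (Hemisphere m)} {S : Hemisphere m} (h : S ∈ L) :
    S ∈ translates L := ⟨S, h, 0, by rw [toC_zero, add_zero]⟩

theorem translates_mono {L L' : List (Hemisphere m)} (h : ∀ S ∈ L, S ∈ L') :
    translates L ⊆ translates L' := fun _ ⟨T, hT, γ, hγ⟩ => ⟨T, h T hT, γ, hγ⟩

theorem mem_translates_of_center_eq {L : List (Hemisphere m)} {S T : Hemisphere m}
    {γ : 𝓞 (QuadField m)} (hT : T ∈ translates L) (h : S.center = T.center + toC γ) :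
    S ∈ translates L := by
  obtain ⟨T₀, hT₀, γ₀, h₀⟩ := hT
  exact ⟨T₀, hT₀, γ₀ + γ, by rw [h, h₀, toC_add, add_assoc]⟩

theorem shift_mem_translates {L : List (Hemisphere m)} {S : Hemisphere m}
    (hS : S ∈ translates L) (γ : 𝓞 (QuadField m)) : S.shift γ ∈ translates L :=
  mem_translates_of_center_eq hS (S.center_shift γ)

theorem finite_translates_center_le (L : List (Hemisphere m)) (R : ℝ) :
    {T | T ∈ translates L ∧ ‖T.center‖ ≤ R}.Finite := by
  obtain ⟨M, hM⟩ : ∃ M : ℝ, ∀ T ∈ L, ‖toC T.mu‖ ≤ M := by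
    induction L with
    | nil => exact ⟨0, by simp⟩
    | cons S L ih =>
      obtain ⟨M, hM⟩ := ih
      refine ⟨max M ‖toC S.mu‖, fun T hT => ?_⟩
      rcases List.mem_cons.1 hT with rfl | h
      · exact le_max_right _ _
      · exact (hM T h).trans (le_max_left _ _)
  refine (Hemisphere.finite_norm_mu_center_le m M R).subset ?_
  rintro T ⟨⟨T₀, hT₀, γ, h⟩, hR⟩
  exact ⟨(Hemisphere.norm_mu_eq_of_center_eq h).trans_le (hM T₀ hT₀), hR⟩

theorem Hemisphere.Touch.norm_center_le {S T : Hemisphere m} (h : S.Touch T) :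
    ‖T.center‖ ≤ ‖S.center‖ + 2 := by
  obtain ⟨z, h0, h1⟩ := h.exists_val
  have h2 := norm_sub_center_le h0.le
  have h3 := norm_sub_center_le (h1 ▸ h0.le)
  have h4 : ‖T.center - S.center‖ ≤ ‖T.center - z‖ + ‖z - S.center‖ :=
    norm_sub_le_norm_sub_add_norm_sub ..
  rw [norm_sub_rev] at h3
  have h5 := norm_le_norm_add_norm_sub' T.center S.center
  linarith

theorem finite_touch (L : List (Hemisphere m)) (S : Hemisphere m) :
    {T | T ∈ translates L ∧ S.Touch T}.Finite :=
  (finite_translates_center_le L (‖S.center‖ + 2)).subset fun _ h => ⟨h.1, h.2.norm_center_le⟩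

theorem finite_remains (L : List (Hemisphere m)) (S : Hemisphere m) :
    {z | Remains L S z}.Finite := by
  refine Set.Finite.subset (Set.Finite.biUnion ((finite_touch L S).prod (finite_touch L S))
    (t := fun T => {z | S.agree T.1 ∩ S.agree T.2 = {z}}) fun T _ => ?_) ?_
  · refine Set.Subsingleton.finite fun z hz w hw => ?_
    exact Set.singleton_injective (hz.symm.trans hw)
  · rintro z ⟨⟨T₁, h₁, T₂, h₂, ht₁, ht₂, h⟩, -⟩
    exact Set.mem_biUnion (x := (T₁, T₂)) ⟨⟨h₁, ht₁⟩, h₂, ht₂⟩ h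

theorem finite_vertexHeights (L : List (Hemisphere m)) : (vertexHeights L).Finite := by
  refine Set.Finite.subset (Set.Finite.biUnion (List.finite_toSet L)
    fun S _ => (finite_remains L S).image fun z => √(S.val z)) ?_
  rintro ζ ⟨h0, S, hS, z, hz, hmem⟩
  refine Set.mem_biUnion (x := S) hS ⟨z, hz, ?_⟩
  exact (congrArg Real.sqrt (Hemisphere.mem_surface_iff.1 hmem).2).trans (Real.sqrt_sq h0.le)

/-! ### Unimodular pairs -/

section Coprime

/-- Every nonzero element of an ideal `(p, q)` of a Dedekind domain is a determinant `μ p - lam q`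
with coprime `μ`, `lam`. -/
theorem exists_isCoprime_mul_sub_mul_eq {R : Type*} [CommRing R] [IsDedekindDomain R]
    {p q x : R} (hx : x ≠ 0) (hmem : x ∈ Ideal.span {p, q}) :
    ∃ a b : R, IsCoprime a b ∧ a * p - b * q = x := by
  set I := Ideal.span {p, q} with hI
  -- The complementary ideal `J` satisfies `(x) = I J`.
  obtain ⟨J, hJ⟩ : I ∣ Ideal.span {x} :=
    Ideal.dvd_iff_le.2 ((Ideal.span_singleton_le_iff_mem _).2 hmem)
  have hx0 : Ideal.span {x} ≠ (⊥ : Ideal R) := mt Ideal.span_singleton_eq_bot.1 hx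
  have hI0 : I ≠ 0 := by rintro h; rw [h, zero_mul] at hJ; exact hx0 hJ
  have hJ0 : J ≠ 0 := by rintro h; rw [h, mul_zero] at hJ; exact hx0 hJ
  have hpI : p ∈ I := Ideal.subset_span (by simp)
  have hqI : q ∈ I := Ideal.subset_span (by simp)
  obtain ⟨r, hr, s, hs, hrs⟩ : ∃ r ∈ J, ∃ s ∈ J, p * r + q * s = x := by
    have h : x ∈ I * J := hJ ▸ Ideal.mem_span_singleton_self x
    rw [hI, Ideal.span_insert, Ideal.sup_mul] at h
    obtain ⟨y, hy, z, hz, h⟩ := Submodule.mem_sup.1 h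
    obtain ⟨r, hr, rfl⟩ := Ideal.mem_span_singleton_mul.1 hy
    obtain ⟨s, hs, rfl⟩ := Ideal.mem_span_singleton_mul.1 hz
    exact ⟨r, hr, s, hs, h⟩
  obtain ⟨y, hy⟩ := IsDedekindDomain.exists_sup_span_eq
    (I := J * J) (J := J) Ideal.mul_le_left (mul_ne_zero hJ0 hJ0)
  have hyJ : y ∈ J := hy ▸ Ideal.mem_sup_right (Ideal.mem_span_singleton_self y)
  have hdvd : ∀ c ∈ I, ∃ e, c * y = x * e := fun c hc =>
    Ideal.mem_span_singleton'.1 (hJ ▸ Ideal.mul_mem_mul hc hyJ) |>.imp fun e he => by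
      rw [← he, mul_comm]
  obtain ⟨e, he⟩ := hdvd q hqI
  obtain ⟨f, hf⟩ := hdvd p hpI
  have hdet : (r - e) * p - (-s - f) * q = x := by
    apply mul_left_cancel₀ hx
    linear_combination x * hrs + p * he - q * hf
  refine ⟨r - e, -s - f, ?_, hdet⟩
  -- The ideal `U` generated by the pair contains `J`, hence `e` and `f`; it follows that
  -- `J = J² + (y)` is contained in `J U`, so that `U` is the whole ring.
  set U := Ideal.span {r - e, -s - f} with hU
  have hre : r - e ∈ U := Ideal.subset_span (by simp)
  have hsf : -s - f ∈ U := Ideal.subset_span (by simp)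
  have hJU : J ≤ U := by
    have h : I * J ≤ I * U := by
      rw [← hJ, Ideal.span_singleton_le_iff_mem, ← hdet, mul_comm _ p, mul_comm _ q]
      exact sub_mem (Ideal.mul_mem_mul hpI hre) (Ideal.mul_mem_mul hqI hsf)
    exact Ideal.dvd_iff_le.1 ((mul_dvd_mul_iff_left hI0).1 (Ideal.dvd_iff_le.2 h))
  have heU : e ∈ U := by simpa using sub_mem (hJU hr) hre
  have hfU : f ∈ U := by simpa using sub_mem (neg_mem (hJU hs)) hsf
  have hyU : y ∈ J * U := by
    have h : I * Ideal.span {y} ≤ I * (J * U) := by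
      rw [← mul_assoc, ← hJ, hI, Ideal.span_insert, Ideal.sup_mul,
        Ideal.span_singleton_mul_span_singleton, Ideal.span_singleton_mul_span_singleton,
        sup_le_iff,
        Ideal.span_singleton_le_iff_mem, Ideal.span_singleton_le_iff_mem, he, hf]
      exact ⟨Ideal.mul_mem_mul (Ideal.mem_span_singleton_self x) hfU,
        Ideal.mul_mem_mul (Ideal.mem_span_singleton_self x) heU⟩
    rw [← Ideal.span_singleton_le_iff_mem]
    exact Ideal.dvd_iff_le.1 ((mul_dvd_mul_iff_left hI0).1 (Ideal.dvd_iff_le.2 h))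
  have hJJ : J * ⊤ ≤ J * U := by
    rw [Ideal.mul_top]
    conv_lhs => rw [← hy]
    exact sup_le (Ideal.mul_mono_right hJU) ((Ideal.span_singleton_le_iff_mem _).2 hyU)
  have hUtop : U = ⊤ :=
    top_le_iff.1 (Ideal.dvd_iff_le.1 ((mul_dvd_mul_iff_left hJ0).1 (Ideal.dvd_iff_le.2 hJJ)))
  rw [hU, Ideal.span_insert] at hUtop
  exact (Ideal.isCoprime_span_singleton_iff _ _).1 (Ideal.isCoprime_iff_sup_eq.2 hUtop)

/-- The parabolic transformations fixing the direction `(q, p)` preserve coprimality. -/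
theorem isCoprime_parabolic {R : Type*} [CommRing R] {a b : R} (h : IsCoprime a b) (p q t : R) :
    IsCoprime (a + t * (a * p - b * q) * q) (b + t * (a * p - b * q) * p) := by
  obtain ⟨u, v, huv⟩ := h
  refine ⟨u * (1 - t * p * q) - v * (t * p ^ 2), u * (t * q ^ 2) + v * (1 + t * p * q), ?_⟩
  linear_combination huv

end Coprime

theorem Hemisphere.val_pos_iff {S : Hemisphere m} {z : ℂ} :
    0 < S.val z ↔ ‖toC S.mu * z - toC S.lam‖ < 1 := by
  have h := norm_pos_iff.2 S.toC_mu_ne_zero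
  rw [S.norm_mul_sub, val, radius, sub_pos, sq_lt_sq₀ (norm_nonneg _) (by positivity),
    lt_div_iff₀' h]

theorem exists_val_pos_of_isCoprime {a b : 𝓞 (QuadField m)} (h : IsCoprime a b) {z : ℂ}
    (hz : ‖toC a * z - toC b‖ < 1) : ∃ S : Hemisphere m, 0 < S.val z := by
  have ha : a ≠ 0 := by
    rintro rfl
    have hb := norm_toC_of_isUnit (isCoprime_zero_left.1 h)
    rw [toC_zero, zero_mul, zero_sub, norm_neg, hb] at hz
    exact lt_irrefl _ hz
  exact ⟨⟨a, b, ha, unimodular_of_isCoprime h⟩, Hemisphere.val_pos_iff.2 hz⟩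

/-! ### The complex plane is covered outside the singular points -/

/-- Dirichlet's approximation theorem over `𝓞`, by the pigeonhole principle. -/
theorem exists_norm_mul_sub_le (hm : m ≠ 0) (z : ℂ) {n : ℕ} (hn : 0 < n) :
    ∃ q p : 𝓞 (QuadField m), q ≠ 0 ∧ ‖toC q‖ ≤ n * (1 + √m) ∧
      ‖toC q * z - toC p‖ ≤ (1 + √m) / n := by
  obtain ⟨ω, hω⟩ := exists_toC_eq_sqrtNeg m
  have hs : 0 < √(m : ℝ) := Real.sqrt_pos.2 (by exact_mod_cast Nat.pos_of_ne_zero hm)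
  have hn' : (0 : ℝ) < n := by exact_mod_cast hn
  -- The cell of a complex number, modulo the lattice `ℤ + ℤ√-m`, in a grid of mesh `1 / n`.
  let cell : ℂ → ℕ × ℕ := fun w =>
    (⌊n * Int.fract w.re⌋₊, ⌊n * Int.fract (w.im / √m)⌋₊)
  let el : ℕ × ℕ → 𝓞 (QuadField m) := fun a =>
    ((a.1 : ℤ) : 𝓞 (QuadField m)) + ((a.2 : ℤ) : 𝓞 (QuadField m)) * ω
  have hmaps : ∀ a ∈ Finset.range (n + 1) ×ˢ Finset.range (n + 1),
      cell (toC (el a) * z) ∈ Finset.range n ×ˢ Finset.range n := by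
    have key : ∀ x : ℝ, ⌊n * Int.fract x⌋₊ < n := fun x => by
      rw [Nat.floor_lt (mul_nonneg hn'.le (Int.fract_nonneg x))]
      nlinarith [Int.fract_lt_one x]
    exact fun a _ => Finset.mem_product.2 ⟨Finset.mem_range.2 (key _), Finset.mem_range.2 (key _)⟩
  obtain ⟨a, ha, b, hb, hab, hcell⟩ := Finset.exists_ne_map_eq_of_card_lt_of_maps_to
    (by rw [Finset.card_product, Finset.card_product, Finset.card_range, Finset.card_range]
        exact Nat.mul_lt_mul'' (Nat.lt_succ_self n) (Nat.lt_succ_self n)) hmaps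
  have hel : ∀ a : ℕ × ℕ, toC (el a) = ⟨a.1, a.2 * √m⟩ := fun a => by
    simp only [el, toC_add, toC_mul, toC_intCast, hω]
    apply Complex.ext <;> simp [sqrtNeg_re, sqrtNeg_im]
  have hbound : ∀ u v : ℝ, |u| ≤ 1 → |v| ≤ 1 → ‖(⟨u, v * √m⟩ : ℂ)‖ ≤ 1 + √m := by
    intro u v hu hv
    refine (Complex.norm_le_abs_re_add_abs_im _).trans ?_
    simp only [abs_mul, abs_of_pos hs]
    nlinarith
  simp only [Finset.mem_product, Finset.mem_range] at ha hb
  simp only [cell, Prod.mk.injEq] at hcell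
  have hfl : ∀ x y : ℝ, ⌊n * Int.fract x⌋₊ = ⌊n * Int.fract y⌋₊ →
      |n * (Int.fract x - Int.fract y)| ≤ 1 := by
    intro x y h
    have h1 := Nat.floor_le (mul_nonneg hn'.le (Int.fract_nonneg x))
    have h2 := Nat.floor_le (mul_nonneg hn'.le (Int.fract_nonneg y))
    have h3 := Nat.lt_floor_add_one (n * Int.fract x)
    have h4 := Nat.lt_floor_add_one (n * Int.fract y)
    rw [h] at h1 h3
    rw [mul_sub, abs_le]
    constructor <;> linarith
  set w := toC (el a) * z
  set w' := toC (el b) * z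
  refine ⟨el a - el b, ((⌊w.re⌋ - ⌊w'.re⌋ : ℤ) : 𝓞 (QuadField m)) +
    ((⌊w.im / √m⌋ - ⌊w'.im / √m⌋ : ℤ) : 𝓞 (QuadField m)) * ω, ?_, ?_, ?_⟩
  · intro h
    have h1 : toC (el a) = toC (el b) := by rw [sub_eq_zero.1 h]
    rw [hel, hel, Complex.mk.injEq] at h1
    exact hab (Prod.ext (by exact_mod_cast h1.1)
      (by exact_mod_cast mul_right_cancel₀ hs.ne' h1.2))
  · have h1 : toC (el a - el b) =
        (n : ℂ) * ⟨((a.1 : ℝ) - b.1) / n, ((a.2 : ℝ) - b.2) / n * √m⟩ := by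
      rw [toC_sub, hel, hel]
      apply Complex.ext
      · simp; field_simp
      · simp; field_simp
    rw [h1, norm_mul, Complex.norm_natCast]
    have key : ∀ i j : ℕ, i < n + 1 → j < n + 1 → |((i : ℝ) - j) / n| ≤ 1 := by
      intro i j hi hj
      have hi' : (i : ℝ) ≤ n := by exact_mod_cast Nat.lt_succ_iff.1 hi
      have hj' : (j : ℝ) ≤ n := by exact_mod_cast Nat.lt_succ_iff.1 hj
      have := Nat.cast_nonneg (α := ℝ) i
      have := Nat.cast_nonneg (α := ℝ) j
      rw [abs_div, abs_of_pos hn', div_le_one hn', abs_le]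
      constructor <;> linarith
    exact mul_le_mul_of_nonneg_left (hbound _ _ (key _ _ ha.1 hb.1) (key _ _ ha.2 hb.2)) hn'.le
  · have h1 : toC (el a - el b) * z - toC (((⌊w.re⌋ - ⌊w'.re⌋ : ℤ) : 𝓞 (QuadField m)) +
        ((⌊w.im / √m⌋ - ⌊w'.im / √m⌋ : ℤ) : 𝓞 (QuadField m)) * ω) =
        (1 / n : ℂ) * ⟨n * (Int.fract w.re - Int.fract w'.re),
          n * (Int.fract (w.im / √m) - Int.fract (w'.im / √m)) * √m⟩ := by
      rw [toC_sub (el a) (el b), sub_mul, show toC (el a) * z = w from rfl,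
        show toC (el b) * z = w' from rfl, toC_add, toC_mul, toC_intCast, toC_intCast, hω]
      have hnC : (n : ℂ) ≠ 0 := by exact_mod_cast hn.ne'
      have h2 : ∀ u : ℂ, (1 / n : ℂ) * (n * u) = u := fun u => by field_simp
      have h3 : (⟨n * (Int.fract w.re - Int.fract w'.re),
          n * (Int.fract (w.im / √m) - Int.fract (w'.im / √m)) * √m⟩ : ℂ) =
          n * ⟨Int.fract w.re - Int.fract w'.re,
            (Int.fract (w.im / √m) - Int.fract (w'.im / √m)) * √m⟩ := by
        apply Complex.ext
        · simp
        · simp [mul_assoc]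
      rw [h3, h2]
      apply Complex.ext
      · simp only [Complex.sub_re, Complex.add_re, Complex.intCast_re, Complex.mul_re,
          Complex.intCast_im, sqrtNeg_re, ← Int.self_sub_floor]
        push_cast
        ring
      · simp only [Complex.sub_im, Complex.add_im, Complex.intCast_re, Complex.mul_im,
          Complex.intCast_im, sqrtNeg_re, sqrtNeg_im, ← Int.self_sub_floor]
        push_cast
        field_simp
        ring
    rw [h1, norm_mul, norm_div, norm_one, Complex.norm_natCast, one_div_mul_eq_div]
    exact div_le_div_of_nonneg_right (hbound _ _ (hfl _ _ hcell.1) (hfl _ _ hcell.2)) hn'.le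

/-- Points outside `K` lie strictly below some hemisphere. An approximation `p / q` of `z` is
combined with a determinant `x = μ p - lam q` that is small compared to `q`; it exists because the
module `𝓞 + 𝓞 z` contains arbitrarily short vectors. -/
theorem exists_val_pos_of_notMem (hm : m ≠ 0) {z : ℂ} (hz : z ∉ QuadField m) :
    ∃ S : Hemisphere m, 0 < S.val z := by
  set c : ℝ := 1 + √m with hc
  have hc0 : 0 < c := by positivity
  have hcomb : ∀ a b : 𝓞 (QuadField m), a ≠ 0 → toC a * z - toC b ≠ 0 := by
    intro a b ha h
    have ha' := mt (toC_eq_zero_iff a).1 ha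
    apply hz
    rw [show z = toC b / toC a by rw [eq_div_iff ha']; linear_combination h]
    exact div_mem (toC_mem b) (toC_mem a)
  obtain ⟨n₁, hn₁⟩ := exists_nat_gt (2 * c ^ 4)
  have hn₁0 : (0 : ℝ) < n₁ := lt_trans (by positivity) hn₁
  obtain ⟨β, α, hβ, -, hβα⟩ := exists_norm_mul_sub_le hm z (n := n₁) (by exact_mod_cast hn₁0)
  set v := toC β * z - toC α with hv
  have hv0 : 0 < ‖v‖ := norm_pos_iff.2 (hcomb β α hβ)
  obtain ⟨n, hn⟩ := exists_nat_gt (‖toC β‖ * c / ‖v‖)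
  have hn0 : (0 : ℝ) < n := lt_of_le_of_lt (by positivity) hn
  obtain ⟨q, p, hq, hqn, hqp⟩ := exists_norm_mul_sub_le hm z (n := n) (by exact_mod_cast hn0)
  rw [← hc] at hβα hqn hqp
  have hqC := mt (toC_eq_zero_iff q).1 hq
  have hq1 := one_le_norm_toC hq
  set δ := z - toC p / toC q with hδ
  have hδq : toC q * z - toC p = toC q * δ := by rw [hδ]; field_simp
  have hδ0 : δ ≠ 0 := fun h => hcomb q p hq (by rw [hδq, h, mul_zero])
  have hδ1 : ‖toC q‖ * ‖δ‖ ≤ c / n := by rw [← norm_mul, ← hδq]; exact hqp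
  -- The determinant `x`, with `x / q = v - β δ`.
  set x := β * p - α * q with hx
  have hxq : toC x / toC q = v - toC β * δ := by
    rw [hx, hv, hδ, toC_sub, toC_mul, toC_mul]; field_simp; ring
  have hβδ : ‖toC β * δ‖ < ‖v‖ := by
    rw [norm_mul]
    rw [div_lt_iff₀ hv0] at hn
    have h1 : ‖δ‖ ≤ c / n := by nlinarith [norm_nonneg δ]
    calc ‖toC β‖ * ‖δ‖ ≤ ‖toC β‖ * (c / n) := mul_le_mul_of_nonneg_left h1 (norm_nonneg _)
      _ = ‖toC β‖ * c / n := by ring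
      _ < ‖v‖ := by rw [div_lt_iff₀ hn0]; linarith
  have hx0 : x ≠ 0 := by
    rintro h
    rw [h, toC_zero, zero_div] at hxq
    rw [← sub_eq_zero.1 hxq.symm] at hβδ
    exact lt_irrefl _ hβδ
  have hxlt : ‖toC x / toC q‖ * c ^ 3 < 1 := by
    have h1 : ‖toC x / toC q‖ < 2 * ‖v‖ := by
      rw [hxq]; linarith [norm_sub_le v (toC β * δ)]
    have h2 : 2 * ‖v‖ * c ^ 3 < 1 := by
      have h3 : ‖v‖ * n₁ ≤ c := (le_div_iff₀ hn₁0).1 hβα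
      have h4 : ‖v‖ * (2 * c ^ 4) < c := by nlinarith
      by_contra h
      nlinarith
    have h3 : 0 < c ^ 3 := by positivity
    nlinarith
  have hxmem : x ∈ Ideal.span {p, q} := by
    rw [Ideal.mem_span_pair]; exact ⟨β, -α, by rw [hx]; ring⟩
  obtain ⟨a, b, hab, hdet⟩ := exists_isCoprime_mul_sub_mul_eq hx0 hxmem
  have hxC := mt (toC_eq_zero_iff x).1 hx0
  -- The parabolic parameter `t` minimizes the distance.
  obtain ⟨t, ht⟩ := exists_norm_sub_le hm (-(toC x / toC q + toC a * δ) / (toC x * toC q * δ))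
  have hcop := isCoprime_parabolic hab p q t
  rw [hdet] at hcop
  refine exists_val_pos_of_isCoprime hcop ?_
  have hdetC : toC a * toC p - toC b * toC q = toC x := by
    rw [← hdet, toC_sub, toC_mul, toC_mul]
  have heq : toC (a + t * x * q) * z - toC (b + t * x * p) =
      -(-(toC x / toC q + toC a * δ) / (toC x * toC q * δ) - toC t) * (toC x * toC q * δ) := by
    have h1 : -(toC x / toC q + toC a * δ) / (toC x * toC q * δ) * (toC x * toC q * δ) =
        -(toC x / toC q + toC a * δ) := div_mul_cancel₀ _ (by positivity)
    rw [neg_sub, sub_mul, h1, show z = toC p / toC q + δ by rw [hδ]; ring, toC_add, toC_add,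
      toC_mul, toC_mul, toC_mul, toC_mul, ← hdetC]
    field_simp
    ring
  rw [heq, norm_mul, norm_neg, norm_mul, norm_mul]
  have h1 : ‖toC x‖ = ‖toC x / toC q‖ * ‖toC q‖ := by rw [norm_div]; field_simp
  have h2 : ‖toC q‖ * (‖toC q‖ * ‖δ‖) ≤ c ^ 2 :=
    calc ‖toC q‖ * (‖toC q‖ * ‖δ‖) ≤ n * c * (c / n) :=
          mul_le_mul hqn hδ1 (by positivity) (by positivity)
      _ = c ^ 2 := by field_simp
  calc _ ≤ c * (‖toC x‖ * ‖toC q‖ * ‖δ‖) := mul_le_mul_of_nonneg_right ht (by positivity)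
    _ = ‖toC x / toC q‖ * c * (‖toC q‖ * (‖toC q‖ * ‖δ‖)) := by rw [h1]; ring
    _ ≤ ‖toC x / toC q‖ * c * c ^ 2 := mul_le_mul_of_nonneg_left h2 (by positivity)
    _ < 1 := by linarith [hxlt]

theorem mem_B_iff {p : ℂ × ℝ} : p ∈ B m ↔ 0 < p.2 ∧ ∀ S : Hemisphere m, S.val p.1 ≤ p.2 ^ 2 := by
  simp only [B, upperHalfSpace, Set.mem_ofPred_eq, Hemisphere.one_le_level_iff]

theorem IsSingularPoint.mem_quadField {z : ℂ} (h : IsSingularPoint m z) : z ∈ QuadField m := by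
  obtain ⟨⟨μ, lam, -, rfl, -⟩, -⟩ := h
  exact div_mem (toC_mem lam) (toC_mem μ)

theorem IsSingularPoint.val_le {z : ℂ} (h : IsSingularPoint m z) (S : Hemisphere m) :
    S.val z ≤ 0 := by
  have hcl : IsClosed {p : ℂ × ℝ | S.val p.1 ≤ p.2 ^ 2} :=
    isClosed_le (S.continuous_val.comp continuous_fst) (by fun_prop)
  have h0 : S.val z ≤ (0 : ℝ) ^ 2 :=
    closure_minimal (fun p hp => (mem_B_iff.1 hp).2 S) hcl (frontier_subset_closure h.2)
  simpa using h0

/-- A point that is strictly below no hemisphere is a singular point: it lies in `K`, its ideal is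
not principal since otherwise it would be a centre, and all points of `ℋ` above it belong to `B`.
-/
theorem isSingularPoint_of_val_le (hm : m ≠ 0) {z : ℂ} (h : ∀ S : Hemisphere m, S.val z ≤ 0) :
    IsSingularPoint m z := by
  have hz : z ∈ QuadField m := by
    by_contra hz
    obtain ⟨S, hS⟩ := exists_val_pos_of_notMem hm hz
    exact (h S).not_gt hS
  obtain ⟨p, q, hq, hpq⟩ := exists_div_of_mem hz
  refine ⟨⟨q, p, hq, hpq, ?_⟩, ?_, fun hint => ?_⟩
  · rintro ⟨d, hd⟩
    -- After division by a generator of the ideal, the fraction is the centre of a hemisphere.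
    have hd' : Ideal.span {p, q} = Ideal.span {d} := hd
    obtain ⟨p', hp'⟩ := Ideal.mem_span_singleton.1 (hd' ▸ Ideal.subset_span (by simp) : p ∈ _)
    obtain ⟨q', hq'⟩ := Ideal.mem_span_singleton.1 (hd' ▸ Ideal.subset_span (by simp) : q ∈ _)
    have hd0 : d ≠ 0 := by rintro rfl; exact hq (by rw [hq', zero_mul])
    have hcop : IsCoprime q' p' := by
      obtain ⟨u, v, huv⟩ := Ideal.mem_span_pair.1
        (hd'.symm ▸ Ideal.mem_span_singleton_self d : d ∈ Ideal.span {p, q})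
      refine ⟨v, u, mul_left_cancel₀ hd0 ?_⟩
      linear_combination huv - u * hp' - v * hq'
    have hdC := mt (toC_eq_zero_iff d).1 hd0
    have hqC := mt (toC_eq_zero_iff q).1 hq
    rw [hq', toC_mul] at hqC
    have hq'C := right_ne_zero_of_mul hqC
    obtain ⟨S, hS⟩ := exists_val_pos_of_isCoprime hcop (z := z) (by
      rw [hpq, hp', hq', toC_mul, toC_mul, mul_div_mul_left _ _ hdC, mul_div_cancel₀ _ hq'C,
        sub_self, norm_zero]
      exact one_pos)
    exact (h S).not_gt hS
  · have hlim : Filter.Tendsto (fun ζ : ℝ => (z, ζ)) (nhdsWithin 0 (Set.Ioi 0)) (nhds (z, 0)) :=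
      ((Continuous.prodMk_right z).tendsto 0).mono_left nhdsWithin_le_nhds
    refine mem_closure_of_tendsto hlim (eventually_mem_nhdsWithin.mono fun ζ hζ => ?_)
    exact mem_B_iff.2 ⟨hζ, fun S => (h S).trans (sq_nonneg ζ)⟩
  · exact lt_irrefl _ (mem_B_iff.1 (interior_subset hint)).1

theorem not_isSingularPoint_iff (hm : m ≠ 0) {z : ℂ} :
    ¬ IsSingularPoint m z ↔ ∃ S : Hemisphere m, 0 < S.val z := by
  constructor
  · intro h
    by_contra! hS
    exact h (isSingularPoint_of_val_le hm hS)
  · rintro ⟨S, hS⟩ h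
    exact (h.val_le S).not_gt hS

/-! ### Finitely many hemispheres determine the floor of `B` -/

theorem Hemisphere.inner_center_sub_le (S : Hemisphere m) (v w : ℂ) :
    inner ℝ (S.center - v) w ≤ ‖v - S.center‖ * ‖w‖ := by
  rw [norm_sub_rev]; exact real_inner_le_norm _ _

/-- Among the directions of `±1` and `±√-m`, one makes an angle less than a right angle with any
given vector. -/
theorem exists_inv_mul_re_ge (hm : m ≠ 0) (W : ℂ) : ∃ t : 𝓞 (QuadField m), t ≠ 0 ∧
    ‖toC t‖ ≤ √m ∧ ‖W‖ / (2 * √m) ≤ ((starRingEnd ℂ) (toC t)⁻¹ * W).re := by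
  have hs1 : 1 ≤ √(m : ℝ) := Real.one_le_sqrt.2 (by exact_mod_cast Nat.pos_of_ne_zero hm)
  have hs : 0 < √(m : ℝ) := by linarith
  obtain ⟨ω, hω⟩ := exists_toC_eq_sqrtNeg m
  have hω0 : ω ≠ 0 := by
    rintro rfl
    have := congrArg Complex.im hω
    rw [toC_zero, sqrtNeg_im] at this
    exact hs.ne this
  have hωinv : (starRingEnd ℂ) (sqrtNeg m)⁻¹ = Complex.I / √m := by
    have : (√(m : ℝ) : ℂ) ≠ 0 := by exact_mod_cast hs.ne'
    rw [sqrtNeg, map_inv₀, map_mul, Complex.conj_I, Complex.conj_ofReal]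
    field_simp
    simp
  have hre : (Complex.I / √m * W).re = -(W.im / √m) := by
    rw [div_mul_eq_mul_div, Complex.div_ofReal_re, Complex.I_mul_re, neg_div]
  have hW := Complex.norm_le_abs_re_add_abs_im W
  have hdiv : ‖W‖ / (2 * √m) = ‖W‖ / 2 / √m := by rw [div_div]
  rw [hdiv]
  have hle : ‖W‖ / 2 / √m ≤ ‖W‖ / 2 := div_le_self (by positivity) hs1
  rcases le_total (‖W‖ / 2) |W.re| with h | h
  · rcases abs_cases W.re with ⟨h1, -⟩ | ⟨h1, -⟩
    · exact ⟨1, one_ne_zero, by simpa [toC_one] using hs1, by simp [toC_one]; linarith⟩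
    · refine ⟨-1, neg_ne_zero.2 one_ne_zero, by simpa [toC_one, toC_neg] using hs1, ?_⟩
      simp [toC_one, toC_neg, inv_neg]; linarith
  · have h2 : ‖W‖ / 2 ≤ |W.im| := by linarith
    rcases abs_cases W.im with ⟨h1, -⟩ | ⟨h1, -⟩
    · refine ⟨-ω, neg_ne_zero.2 hω0, by rw [toC_neg, norm_neg, hω, norm_sqrtNeg], ?_⟩
      rw [toC_neg, hω, inv_neg, map_neg, hωinv, neg_mul, Complex.neg_re, hre, neg_neg]
      exact div_le_div_of_nonneg_right (by linarith) hs.le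
    · refine ⟨ω, hω0, by rw [hω, norm_sqrtNeg], ?_⟩
      rw [hω, hωinv, hre, ← neg_div]
      exact div_le_div_of_nonneg_right (by linarith) hs.le

/-- At `z`, some hemisphere with `|μ| ≤ R` has positive height and is strictly above all
hemispheres with `|μ| > R`. -/
def DominatedAt (m : ℕ) (R : ℝ) (z : ℂ) : Prop :=
  ∃ S : Hemisphere m, ‖toC S.mu‖ ≤ R ∧ 0 < S.val z ∧
    ∀ S' : Hemisphere m, R < ‖toC S'.mu‖ → S'.val z < S.val z

theorem DominatedAt.mono {R R' : ℝ} (h : R ≤ R') {z : ℂ} (hz : DominatedAt m R z) :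
    DominatedAt m R' z := by
  obtain ⟨S, h1, h2, h3⟩ := hz
  exact ⟨S, h1.trans h, h2, fun S' h' => h3 S' (h.trans_lt h')⟩

theorem eventually_dominatedAt_of_val_pos {z₀ : ℂ} {S : Hemisphere m} (hS : 0 < S.val z₀) :
    ∃ R, ∀ᶠ z in nhds z₀, DominatedAt m R z := by
  refine ⟨max ‖toC S.mu‖ (1 / (S.val z₀ / 2)), ?_⟩
  filter_upwards [S.continuous_val.continuousAt.eventually (lt_mem_nhds (half_lt_self hS))]
    with z hz
  refine ⟨S, le_max_left _ _, (half_pos hS).trans hz, fun S' h => ?_⟩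
  have h1 : S'.radius < S.val z₀ / 2 :=
    (one_div_lt (norm_pos_iff.2 S'.toC_mu_ne_zero) (half_pos hS)).2
      ((le_max_right _ _).trans_lt h)
  have h2 := S'.val_le_radius_sq z
  have h3 := S'.radius_le_one
  have h4 := S'.radius_pos
  nlinarith

/-- Near an uncovered fraction `p / q`, the hemispheres `S_{t q², t p q - 1}` through that point,
for `t = ±1, ±√-m`, dominate all hemispheres of small radius: those through the point because
their centres are close to it, the others because `|μ p - lam q|² ≥ |q|² + 1` keeps them away from
it. -/
theorem eventually_dominatedAt_of_val_le (hm : m ≠ 0) {z₀ : ℂ}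
    (h₀ : ∀ S : Hemisphere m, S.val z₀ ≤ 0) {p q : 𝓞 (QuadField m)} (hq : q ≠ 0)
    (hpq : z₀ = toC p / toC q) :
    ∃ R, ∀ᶠ z in nhds z₀, z ≠ z₀ → DominatedAt m R z := by
  have hs1 : 1 ≤ √(m : ℝ) := Real.one_le_sqrt.2 (by exact_mod_cast Nat.pos_of_ne_zero hm)
  have hqC := mt (toC_eq_zero_iff q).1 hq
  set Q := ‖toC q‖ with hQ
  have hQ0 : 0 < Q := norm_pos_iff.2 hqC
  set h₁ : ℝ := 1 / Q ^ 2 / (2 * √m) with hh₁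
  have hh₁0 : 0 < h₁ := by positivity
  refine ⟨max (√m * Q ^ 2) (2 / h₁), ?_⟩
  have hρ : 0 < h₁ / (4 * (Q ^ 2 + 1)) := by positivity
  filter_upwards [Metric.ball_mem_nhds z₀ hρ] with z hz hne
  set δ := z - z₀ with hδ
  have hd0 : 0 < ‖δ‖ := norm_pos_iff.2 (sub_ne_zero.2 hne)
  have hdρ : ‖δ‖ < h₁ / (4 * (Q ^ 2 + 1)) := by rwa [← mem_ball_iff_norm]
  have hzδ : z = z₀ + δ := by rw [hδ]; ring
  have hd1 : ‖δ‖ ≤ h₁ := hdρ.le.trans (div_le_self hh₁0.le (by nlinarith))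
  obtain ⟨t, ht0, htm, ht⟩ := exists_inv_mul_re_ge hm
    ((starRingEnd ℂ) (-(1 / toC q ^ 2)) * δ)
  have htC := mt (toC_eq_zero_iff t).1 ht0
  have hcop : IsCoprime (t * q * q) (-1 + t * q * p) := by
    simpa using isCoprime_parabolic
      (isCoprime_zero_left.2 isUnit_one.neg : IsCoprime (0 : 𝓞 (QuadField m)) (-1)) p q t
  let S : Hemisphere m := ⟨t * q * q, -1 + t * q * p, mul_ne_zero (mul_ne_zero ht0 hq) hq,
    unimodular_of_isCoprime hcop⟩
  have hSmu : ‖toC S.mu‖ = ‖toC t‖ * Q ^ 2 := by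
    change ‖toC (t * q * q)‖ = _
    rw [toC_mul, toC_mul, norm_mul, norm_mul]; ring
  have hSc : S.center - z₀ = (toC t)⁻¹ * (-(1 / toC q ^ 2)) := by
    change toC (-1 + t * q * p) / toC (t * q * q) - z₀ = _
    rw [hpq, toC_add, toC_mul, toC_mul, toC_mul, toC_mul, toC_neg, toC_one]
    field_simp
    ring
  have hSz₀ : S.val z₀ = 0 := by
    have h1 : ‖z₀ - S.center‖ = S.radius := by
      rw [norm_sub_rev, hSc, Hemisphere.radius, hSmu, norm_mul, norm_neg, norm_inv, norm_div,
        norm_one, norm_pow, ← hQ]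
      field_simp
    rw [Hemisphere.val, h1, sub_self]
  have hinner : h₁ * ‖δ‖ ≤ inner ℝ (S.center - z₀) δ := by
    have h1 : inner ℝ (S.center - z₀) δ =
        ((starRingEnd ℂ) (toC t)⁻¹ * ((starRingEnd ℂ) (-(1 / toC q ^ 2)) * δ)).re := by
      rw [Complex.inner, hSc, map_mul]
      congr 1
      ring
    rw [h1]
    refine le_trans (le_of_eq ?_) ht
    rw [norm_mul, Complex.norm_conj, norm_neg, norm_div, norm_one, norm_pow, hh₁]
    ring
  have hSz : h₁ * ‖δ‖ ≤ S.val z := by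
    rw [hzδ, S.val_add, hSz₀]
    nlinarith
  refine ⟨S, ?_, lt_of_lt_of_le (by positivity) hSz, fun S' hS' => lt_of_lt_of_le ?_ hSz⟩
  · rw [hSmu]
    exact (mul_le_mul_of_nonneg_right htm (by positivity)).trans (le_max_left _ _)
  -- The radius `r` of a competitor is small, and `k` is the distance of its centre from `p / q`.
  set r := S'.radius with hr
  set k := ‖z₀ - S'.center‖ with hk
  have hr0 : 0 < r := S'.radius_pos
  have hr1 : 2 * r < h₁ := by
    have h1 : 2 / h₁ < ‖toC S'.mu‖ := (le_max_right _ _).trans_lt hS'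
    have h2 := S'.radius_mul_norm_mu
    rw [div_lt_iff₀ hh₁0] at h1
    rw [← hr] at h2
    nlinarith
  have hval₀ : S'.val z₀ = r ^ 2 - k ^ 2 := rfl
  have hle : S'.val z ≤ r ^ 2 - k ^ 2 + 2 * (k * ‖δ‖) - ‖δ‖ ^ 2 := by
    rw [hzδ, S'.val_add, hval₀]
    linarith [S'.inner_center_sub_le z₀ δ]
  have hk0 : 0 ≤ k := norm_nonneg _
  have hrk : r ≤ k := le_of_sq_le_sq (by linarith [h₀ S']) hk0
  rcases hrk.eq_or_lt with hrk | hrk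
  · rw [← hrk] at hle
    nlinarith
  · have hx : ‖toC (S'.mu * p - S'.lam * q)‖ = ‖toC S'.mu‖ * k * Q := by
      have h1 := S'.norm_mul_sub z₀
      rw [← hk] at h1
      rw [← h1, hQ, ← norm_mul, hpq, toC_sub, toC_mul, toC_mul, sub_mul, mul_assoc,
        div_mul_cancel₀ _ hqC]
    have hmu0 := norm_pos_iff.2 S'.toC_mu_ne_zero
    have hmur : ‖toC S'.mu‖ * r = 1 := by rw [mul_comm]; exact S'.radius_mul_norm_mu
    have hlt : ‖toC q‖ < ‖toC (S'.mu * p - S'.lam * q)‖ := by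
      rw [hx, ← hQ]
      have : 1 < ‖toC S'.mu‖ * k := by rw [← hmur]; exact mul_lt_mul_of_pos_left hrk hmu0
      nlinarith
    have hgap := norm_sq_add_one_le hlt
    rw [hx, ← hQ] at hgap
    have hrQ : r ^ 2 * (Q ^ 2 + 1) ≤ k ^ 2 * Q ^ 2 :=
      calc r ^ 2 * (Q ^ 2 + 1) ≤ r ^ 2 * (‖toC S'.mu‖ * k * Q) ^ 2 :=
            mul_le_mul_of_nonneg_left hgap (by positivity)
        _ = (‖toC S'.mu‖ * r) ^ 2 * (k ^ 2 * Q ^ 2) := by ring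
        _ = k ^ 2 * Q ^ 2 := by rw [hmur]; ring
    rcases lt_or_ge (2 * k) h₁ with hkh | hkh
    · nlinarith
    · have h1 : (r ^ 2 - k ^ 2) * (Q ^ 2 + 1) ≤ -k ^ 2 := by linarith
      have h2 : ‖δ‖ * (4 * (Q ^ 2 + 1)) < 2 * k :=
        ((lt_div_iff₀ (by positivity)).1 hdρ).trans_le hkh
      have h3 : (r ^ 2 - k ^ 2 + 2 * (k * ‖δ‖)) * (Q ^ 2 + 1) ≤ 0 := by
        linarith [mul_le_mul_of_nonneg_left h2.le hk0]
      have h4 : r ^ 2 - k ^ 2 + 2 * (k * ‖δ‖) ≤ 0 :=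
        nonpos_of_mul_nonpos_left h3 (by positivity)
      linarith [mul_pos hh₁0 hd0, sq_nonneg ‖δ‖]

/-- Swan's finiteness theorem: outside the singular points, the floor of `B` is formed by the
hemispheres with `|μ|` below some bound. -/
theorem exists_dominatedAt (hm : m ≠ 0) :
    ∃ R, ∀ z, ¬ IsSingularPoint m z → DominatedAt m R z := by
  have hloc : ∀ z₀ : ℂ, ∃ R, ∀ᶠ z in nhds z₀, ¬ IsSingularPoint m z → DominatedAt m R z := by
    intro z₀
    by_cases h : ∃ S : Hemisphere m, 0 < S.val z₀
    · obtain ⟨S, hS⟩ := h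
      obtain ⟨R, hR⟩ := eventually_dominatedAt_of_val_pos hS
      exact ⟨R, hR.mono fun z hz _ => hz⟩
    · push Not at h
      have hsing := isSingularPoint_of_val_le hm h
      obtain ⟨p, q, hq, hpq⟩ := exists_div_of_mem hsing.mem_quadField
      obtain ⟨R, hR⟩ := eventually_dominatedAt_of_val_le hm h hq hpq
      exact ⟨R, hR.mono fun z hz hz' => hz (by rintro rfl; exact hz' hsing)⟩
  choose R hR using hloc
  obtain ⟨t, -, ht⟩ := (isCompact_closedBall (0 : ℂ) (1 + √m)).elim_nhds_subcover
    (fun z₀ => {z | ¬ IsSingularPoint m z → DominatedAt m (R z₀) z}) fun z₀ _ => hR z₀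
  obtain ⟨M, hM⟩ := (t.finite_toSet.image R).bddAbove
  refine ⟨M, fun z hz => ?_⟩
  obtain ⟨γ, hγ⟩ := exists_norm_sub_le hm z
  have hz' : ¬ IsSingularPoint m (z - toC γ) := by
    rw [not_isSingularPoint_iff hm] at hz ⊢
    obtain ⟨S, hS⟩ := hz
    refine ⟨S.shift (-γ), ?_⟩
    rwa [sub_eq_add_neg, ← toC_neg, S.val_shift]
  obtain ⟨z₀, hz₀, hmem⟩ := Set.mem_iUnion₂.1 (ht (mem_closedBall_zero_iff.2 hγ))
  obtain ⟨S, h1, h2, h3⟩ := (hmem hz').mono (hM ⟨z₀, hz₀, rfl⟩)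
  have hshift : ∀ T : Hemisphere m, (T.shift γ).val z = T.val (z - toC γ) := fun T => by
    rw [← T.val_shift γ, sub_add_cancel]
  refine ⟨S.shift γ, h1, by rwa [hshift], fun S' hS' => ?_⟩
  have h4 := h3 (S'.shift (-γ)) hS'
  rwa [hshift, ← S'.val_shift (-γ) z, toC_neg, ← sub_eq_add_neg]

/-! ### Vertices up to translation -/

namespace Hemisphere

theorem agree_of_center_eq {S S₀ T T₀ : Hemisphere m} {γ : 𝓞 (QuadField m)}
    (hS : S.center = S₀.center + toC γ) (hT : T.center = T₀.center + toC γ) :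
    S.agree T = (fun z => z - toC γ) ⁻¹' S₀.agree T₀ := by
  ext z
  rw [Set.mem_preimage, mem_agree_iff, mem_agree_iff, ← val_add_eq hS, ← val_add_eq hT,
    sub_add_cancel]

theorem Touch.of_center_eq {S S₀ T T₀ : Hemisphere m} {γ : 𝓞 (QuadField m)}
    (hS : S.center = S₀.center + toC γ) (hT : T.center = T₀.center + toC γ) (h : S.Touch T) :
    S₀.Touch T₀ := by
  obtain ⟨z, h0, h1⟩ := h.exists_val
  refine touch_of_val_eq (z := z - toC γ) ?_ ?_
  · rwa [← val_add_eq hS, sub_add_cancel]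
  · rwa [← val_add_eq hS, ← val_add_eq hT, sub_add_cancel]

theorem center_eq_shift_neg_add (T : Hemisphere m) (γ : 𝓞 (QuadField m)) :
    T.center = (T.shift (-γ)).center + toC γ := by
  rw [center_shift, toC_neg, neg_add_cancel_right]

/-- `z` is a vertex referring to `S`, cut out by two hemispheres that touch `S`. -/
def IsVertex (S T₁ T₂ : Hemisphere m) (z : ℂ) : Prop :=
  S.Touch T₁ ∧ S.Touch T₂ ∧ S.agree T₁ ∩ S.agree T₂ = {z}

theorem IsVertex.of_center_eq {S S₀ T₁ T₂ T₁' T₂' : Hemisphere m} {z : ℂ} {γ : 𝓞 (QuadField m)}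
    (hS : S.center = S₀.center + toC γ) (h₁ : T₁.center = T₁'.center + toC γ)
    (h₂ : T₂.center = T₂'.center + toC γ) (h : S.IsVertex T₁ T₂ z) :
    S₀.IsVertex T₁' T₂' (z - toC γ) := by
  refine ⟨h.1.of_center_eq hS h₁, h.2.1.of_center_eq hS h₂, ?_⟩
  have h3 := h.2.2
  rw [agree_of_center_eq hS h₁, agree_of_center_eq hS h₂, ← Set.preimage_inter] at h3
  ext w
  have h4 := Set.ext_iff.1 h3 (w + toC γ)
  rw [Set.mem_preimage, add_sub_cancel_right] at h4
  rw [h4, Set.mem_singleton_iff, Set.mem_singleton_iff, eq_sub_iff_add_eq]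

end Hemisphere

theorem remains_iff {L : List (Hemisphere m)} {S : Hemisphere m} {z : ℂ} :
    Remains L S z ↔ (∃ T₁ ∈ translates L, ∃ T₂ ∈ translates L, S.IsVertex T₁ T₂ z) ∧
      ∀ T ∈ translates L, T.val z ≤ S.val z := by
  simp only [Remains, Hemisphere.IsVertex, Hemisphere.strictlyBelowAt_iff, not_lt]

theorem Remains.of_center_eq {L : List (Hemisphere m)} {S S₀ : Hemisphere m} {z : ℂ}
    {γ : 𝓞 (QuadField m)} (hS : S.center = S₀.center + toC γ) (h : Remains L S z) :
    Remains L S₀ (z - toC γ) := by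
  rw [remains_iff] at h ⊢
  obtain ⟨⟨T₁, h₁, T₂, h₂, hv⟩, hmax⟩ := h
  refine ⟨⟨T₁.shift (-γ), shift_mem_translates h₁ _, T₂.shift (-γ), shift_mem_translates h₂ _,
    hv.of_center_eq hS (T₁.center_eq_shift_neg_add γ) (T₂.center_eq_shift_neg_add γ)⟩,
    fun T hT => ?_⟩
  have h3 := hmax _ (shift_mem_translates hT γ)
  rwa [← Hemisphere.val_add_eq hS, ← T.val_shift γ, sub_add_cancel]

/-- Up to translation, there are finitely many vertices cut out by hemispheres with bounded `|μ|`;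
hence the positive heights of such vertices are bounded away from zero. -/
theorem exists_le_height (hm : m ≠ 0) (R : ℝ) : ∃ η > 0, ∀ (S T₁ T₂ : Hemisphere m) (z : ℂ) (ζ : ℝ),
    ‖toC S.mu‖ ≤ R → ‖toC T₁.mu‖ ≤ R → ‖toC T₂.mu‖ ≤ R → S.IsVertex T₁ T₂ z → 0 < ζ →
    S.val z = ζ ^ 2 → η ≤ ζ := by
  set F := {S : Hemisphere m | ‖toC S.mu‖ ≤ R ∧ ‖S.center‖ ≤ 1 + √m + 2}
  have hF : F.Finite := Hemisphere.finite_norm_mu_center_le m R _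
  set H := {ζ : ℝ | 0 < ζ ∧ ∃ S ∈ F, ∃ T₁ ∈ F, ∃ T₂ ∈ F, ∃ z, S.IsVertex T₁ T₂ z ∧
    S.val z = ζ ^ 2} with hH
  have hHfin : H.Finite := by
    refine Set.Finite.subset (Set.Finite.biUnion (hF.prod (hF.prod hF)) (t := fun T =>
      {ζ | 0 < ζ ∧ ∃ z, T.1.IsVertex T.2.1 T.2.2 z ∧ T.1.val z = ζ ^ 2}) fun T _ => ?_) ?_
    · refine Set.Subsingleton.finite ?_
      rintro ζ ⟨h0, z, hz, h1⟩ ζ' ⟨h0', z', hz', h1'⟩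
      obtain rfl : z = z' := Set.singleton_injective (hz.2.2.symm.trans hz'.2.2)
      exact (pow_left_inj₀ h0.le h0'.le two_ne_zero).1 (h1.symm.trans h1')
    · rintro ζ ⟨h0, S, hS, T₁, h₁, T₂, h₂, h⟩
      exact Set.mem_biUnion (x := (S, T₁, T₂)) ⟨hS, h₁, h₂⟩ ⟨h0, h⟩
  have hmain : ∀ (S T₁ T₂ : Hemisphere m) (z : ℂ) (ζ : ℝ),
      ‖toC S.mu‖ ≤ R → ‖toC T₁.mu‖ ≤ R → ‖toC T₂.mu‖ ≤ R → S.IsVertex T₁ T₂ z → 0 < ζ →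
      S.val z = ζ ^ 2 → ζ ∈ H := by
    intro S T₁ T₂ z ζ hS h₁ h₂ hv h0 hζ
    obtain ⟨γ, hγ⟩ := exists_norm_sub_le hm S.center
    have hc := S.center_eq_shift_neg_add γ
    have hv' := hv.of_center_eq hc (T₁.center_eq_shift_neg_add γ) (T₂.center_eq_shift_neg_add γ)
    have hn : ‖(S.shift (-γ)).center‖ ≤ 1 + √m := by
      rwa [Hemisphere.center_shift, toC_neg, ← sub_eq_add_neg]
    refine ⟨h0, S.shift (-γ), ⟨hS, by linarith⟩, T₁.shift (-γ), ⟨h₁, ?_⟩, T₂.shift (-γ),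
      ⟨h₂, ?_⟩, _, hv', ?_⟩
    · exact hv'.1.norm_center_le.trans (by linarith)
    · exact hv'.2.1.norm_center_le.trans (by linarith)
    · rw [← hζ, ← Hemisphere.val_add_eq hc, sub_add_cancel]
  rcases H.eq_empty_or_nonempty with he | hne
  · exact ⟨1, one_pos, fun S T₁ T₂ z ζ hS h₁ h₂ hv h0 hζ =>
      absurd (hmain S T₁ T₂ z ζ hS h₁ h₂ hv h0 hζ) (he ▸ Set.notMem_empty ζ)⟩
  · obtain ⟨η, hη, hmin⟩ := Set.exists_min_image H id hHfin hne
    exact ⟨η, hη.1, fun S T₁ T₂ z ζ hS h₁ h₂ hv h0 hζ =>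
      hmin ζ (hmain S T₁ T₂ z ζ hS h₁ h₂ hv h0 hζ)⟩

/-! ### The upper envelope of a finite list and its translates -/

/-- Among the translates of the list, `S` is one of the highest at `z`. -/
def IsTop (L : List (Hemisphere m)) (z : ℂ) (S : Hemisphere m) : Prop :=
  S ∈ translates L ∧ ∀ T ∈ translates L, T.val z ≤ S.val z

theorem IsTop.val_eq {L : List (Hemisphere m)} {z : ℂ} {S T : Hemisphere m}
    (hS : IsTop L z S) (hT : IsTop L z T) : S.val z = T.val z :=
  le_antisymm (hT.2 S hS.1) (hS.2 T hT.1)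

theorem finite_translates_val_ge (L : List (Hemisphere m)) (v : ℂ) (a : ℝ) :
    {T | T ∈ translates L ∧ ∃ w, ‖w - v‖ ≤ 1 ∧ a ≤ T.val w}.Finite := by
  refine (finite_translates_center_le L (‖v‖ + 2 + |a|)).subset ?_
  rintro T ⟨hT, w, hw, ha⟩
  refine ⟨hT, ?_⟩
  have h1 : ‖w - T.center‖ ^ 2 ≤ (1 + |a|) ^ 2 := by
    have h2 := pow_le_one₀ (n := 2) T.radius_pos.le T.radius_le_one
    unfold Hemisphere.val at ha
    have h3 := neg_abs_le a
    nlinarith [abs_nonneg a]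
  have h2 := le_of_sq_le_sq h1 (by positivity)
  have h3 : ‖T.center‖ ≤ ‖v‖ + ‖T.center - v‖ := by
    simpa using norm_add_le v (T.center - v)
  have h4 : ‖T.center - v‖ ≤ ‖T.center - w‖ + ‖w - v‖ := norm_sub_le_norm_sub_add_norm_sub ..
  rw [norm_sub_rev] at h2
  linarith

theorem exists_isTop {L : List (Hemisphere m)} (hL : (translates L).Nonempty) (z : ℂ) :
    ∃ S, IsTop L z S := by
  obtain ⟨T₀, hT₀⟩ := hL
  have hfin : {T | T ∈ translates L ∧ T₀.val z ≤ T.val z}.Finite :=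
    (finite_translates_val_ge L z (T₀.val z)).subset fun T hT => ⟨hT.1, z, by simp, hT.2⟩
  obtain ⟨S, hS, hmax⟩ := Set.exists_max_image _ (fun T => T.val z) hfin ⟨T₀, hT₀, le_rfl⟩
  refine ⟨S, hS.1, fun T hT => ?_⟩
  rcases le_total (T₀.val z) (T.val z) with h | h
  · exact hmax T ⟨hT, h⟩
  · exact h.trans hS.2

/-- The hemispheres on top at nearby points are on top at the given point. -/
theorem eventually_isTop {L : List (Hemisphere m)} (hL : (translates L).Nonempty) (v : ℂ) :
    ∀ᶠ w in nhds v, ∀ S, IsTop L w S → IsTop L v S := by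
  obtain ⟨T₀, h₀⟩ := exists_isTop hL v
  have hfin := finite_translates_val_ge L v (T₀.val v - 1)
  have h1 : ∀ᶠ w in nhds v,
      ∀ S ∈ {T | T ∈ translates L ∧ ∃ w, ‖w - v‖ ≤ 1 ∧ T₀.val v - 1 ≤ T.val w},
      S.val v < T₀.val v → S.val w < T₀.val w := by
    rw [Filter.eventually_all_finite hfin]
    intro S _
    by_cases h : S.val v < T₀.val v
    · exact (S.continuous_val.continuousAt.eventually_lt T₀.continuous_val.continuousAt h).mono
        fun w hw _ => hw
    · exact Filter.Eventually.of_forall fun w h' => absurd h' h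
  filter_upwards [h1, Metric.ball_mem_nhds v one_pos,
    T₀.continuous_val.continuousAt.eventually (lt_mem_nhds (sub_one_lt (T₀.val v)))]
    with w hw hball hT₀w S hS
  refine ⟨hS.1, fun T hT => (h₀.2 T hT).trans ?_⟩
  by_contra! hlt
  have h2 := hS.2 T₀ h₀.1
  exact (hw S ⟨hS.1, w, (mem_ball_iff_norm.1 hball).le, hT₀w.le.trans h2⟩ hlt).not_ge h2

theorem isClosed_setOf_isTop (L : List (Hemisphere m)) (S : Hemisphere m) :
    IsClosed {z | IsTop L z S} := by
  have : {z | IsTop L z S} =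
      {z | S ∈ translates L} ∩ ⋂ T ∈ translates L, {z | T.val z ≤ S.val z} := by
    ext z; simp [IsTop]
  rw [this]
  exact isClosed_const.inter
    (isClosed_biInter fun T _ => isClosed_le T.continuous_val S.continuous_val)

/-- Two lines of agreement meet in a single point if the three centres are not collinear. -/
theorem Hemisphere.agree_inter_eq_singleton {S T₁ T₂ : Hemisphere m} {v : ℂ}
    (h₁ : T₁.val v = S.val v) (h₂ : T₂.val v = S.val v)
    (h : inner ℝ (T₁.center - S.center) (Complex.I * (T₂.center - S.center)) ≠ 0) :
    S.agree T₁ ∩ S.agree T₂ = {v} := by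
  have key : ∀ T : Hemisphere m, T.val v = S.val v → ∀ z, z ∈ S.agree T ↔
      inner ℝ (T.center - S.center) (z - v) = 0 := by
    intro T hT z
    have := S.val_sub_val_smul T v (z - v) 1
    rw [one_smul, add_sub_cancel, hT] at this
    rw [Hemisphere.mem_agree_iff]
    constructor <;> intro h' <;> linarith
  ext z
  rw [Set.mem_inter_iff, key _ h₁, key _ h₂, Set.mem_singleton_iff]
  constructor
  · rintro ⟨h3, h4⟩
    set a := T₁.center - S.center
    set b := T₂.center - S.center
    simp only [Complex.inner, Complex.mul_re, Complex.conj_re, Complex.conj_im, Complex.mul_im,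
      Complex.I_re, Complex.I_im] at h h3 h4
    rw [← sub_eq_zero]
    set y := z - v
    have hdet : a.im * b.re - a.re * b.im ≠ 0 := fun h0 => h (by linarith)
    apply Complex.ext
    · refine (mul_eq_zero.1 ?_).resolve_left hdet
      linear_combination a.im * h4 - b.im * h3
    · refine (mul_eq_zero.1 ?_).resolve_left hdet
      linear_combination b.re * h3 - a.re * h4
  · rintro rfl
    simp

/-- If no two hemispheres on top at `v` cut out a vertex together with `S`, then the centres of the
hemispheres on top lie on a line, and `S` stays on top when `v` moves perpendicularly to it. -/
theorem IsTop.exists_eventually_isTop {L : List (Hemisphere m)} {v : ℂ} {S : Hemisphere m}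
    (hS : IsTop L v S)
    (hcol : ¬ ∃ T₁ T₂, IsTop L v T₁ ∧ IsTop L v T₂ ∧ S.agree T₁ ∩ S.agree T₂ = {v}) :
    ∃ d : ℂ, d ≠ 0 ∧ (∀ T, IsTop L v T → inner ℝ (T.center - S.center) d = 0) ∧
      ∀ᶠ t in nhds (0 : ℝ), IsTop L (v + t • d) S := by
  obtain ⟨d, hd, hperp⟩ : ∃ d : ℂ, d ≠ 0 ∧
      ∀ T, IsTop L v T → inner ℝ (T.center - S.center) d = 0 := by
    by_cases h : ∃ T, IsTop L v T ∧ T.center - S.center ≠ 0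
    · obtain ⟨T₂, hT₂, hne⟩ := h
      refine ⟨Complex.I * (T₂.center - S.center), mul_ne_zero Complex.I_ne_zero hne,
        fun T₁ hT₁ => ?_⟩
      by_contra hne'
      exact hcol ⟨T₁, T₂, hT₁, hT₂, Hemisphere.agree_inter_eq_singleton (hT₁.val_eq hS)
        (hT₂.val_eq hS) hne'⟩
    · push Not at h
      exact ⟨1, one_ne_zero, fun T hT => by rw [h T hT, inner_zero_left]⟩
  refine ⟨d, hd, hperp, ?_⟩
  have hlim : Filter.Tendsto (fun t : ℝ => v + t • d) (nhds 0) (nhds v) := by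
    have : Continuous fun t : ℝ => v + t • d := by fun_prop
    simpa using this.tendsto 0
  filter_upwards [hlim.eventually (eventually_isTop ⟨S, hS.1⟩ v)] with t ht
  obtain ⟨T, hT⟩ := exists_isTop ⟨S, hS.1⟩ (v + t • d)
  have h1 := S.val_sub_val_smul T v d t
  rw [hperp T (ht T hT), (ht T hT).val_eq hS] at h1
  exact ⟨hS.1, fun T' hT' => (hT.2 T' hT').trans (by linarith)⟩

theorem not_mem_extremePoints {C : Set ℂ} {v d : ℂ} (hd : d ≠ 0)
    (h : ∀ᶠ t in nhds (0 : ℝ), v + t • d ∈ C) : v ∉ C.extremePoints ℝ := by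
  intro hv
  obtain ⟨ε, hε, hball⟩ := Metric.eventually_nhds_iff.1 h
  have h1 : v + (ε / 2) • d ∈ C := hball (by
    rw [Real.dist_eq, sub_zero, abs_of_pos (half_pos hε)]; exact half_lt_self hε)
  have h2 : v + (-(ε / 2)) • d ∈ C := hball (by
    rw [Real.dist_eq, sub_zero, abs_neg, abs_of_pos (half_pos hε)]; exact half_lt_self hε)
  have h3 := (mem_extremePoints.1 hv).2 _ h1 _ h2
    ⟨1 / 2, 1 / 2, by norm_num, by norm_num, by norm_num, by
      rw [neg_smul]; module⟩
  have h4 := h3.1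
  rw [add_eq_left, smul_eq_zero] at h4
  exact h4.elim (half_pos hε).ne' hd

/-! ### Collections -/

theorem IsCollection.nonempty {L : List (Hemisphere m)} (hL : IsCollection L) :
    (translates L).Nonempty := by
  obtain ⟨z, hz⟩ := (dense_compl_quadField m).nonempty
  obtain ⟨S, hS, -⟩ := hL z fun h => hz h.mem_quadField
  exact ⟨S, hS⟩

theorem IsCollection.val_pos {L : List (Hemisphere m)} (hL : IsCollection L) {z : ℂ}
    (hz : ¬ IsSingularPoint m z) {S : Hemisphere m} (hS : IsTop L z S) : 0 < S.val z := by
  obtain ⟨T, hT, h⟩ := hL z hz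
  exact (pointStrictlyBelow_iff.1 h).trans_le (hS.2 T hT)

/-- The upper envelope of a collection is nonnegative, as singular points are not dense. -/
theorem IsCollection.val_nonneg {L : List (Hemisphere m)} (hL : IsCollection L)
    {z : ℂ} {S : Hemisphere m} (hS : IsTop L z S) : 0 ≤ S.val z := by
  by_contra! hneg
  have hne := hL.nonempty
  have hfin : {T | IsTop L z T}.Finite :=
    (finite_translates_val_ge L z (S.val z)).subset fun T hT =>
      ⟨hT.1, z, by simp, (hS.val_eq hT).le⟩
  have h1 : ∀ᶠ w in nhds z, ∀ T ∈ {T | IsTop L z T}, T.val w < 0 := by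
    rw [Filter.eventually_all_finite hfin]
    exact fun T hT => T.continuous_val.continuousAt.eventually
      (gt_mem_nhds (by rwa [← hS.val_eq hT]))
  obtain ⟨w, hw, h2, h3⟩ :=
    (mem_closure_iff_frequently.1 (dense_compl_quadField m z)).and_eventually
    (h1.and (eventually_isTop hne z)) |>.exists
  obtain ⟨T, hT⟩ := exists_isTop hne w
  exact (h2 T (h3 T hT)).not_gt (hL.val_pos (fun h => hw h.mem_quadField) hT)

theorem remains_of_isTop {L : List (Hemisphere m)} {S T₁ T₂ : Hemisphere m} {v : ℂ}
    (hS : IsTop L v S) (h₁ : IsTop L v T₁) (h₂ : IsTop L v T₂) (ht₁ : S.Touch T₁)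
    (ht₂ : S.Touch T₂) (h : S.agree T₁ ∩ S.agree T₂ = {v}) : Remains L S v :=
  remains_iff.2 ⟨⟨T₁, h₁.1, T₂, h₂.1, ht₁, ht₂, h⟩, hS.2⟩

theorem remains_of_isTop_of_val_pos {L : List (Hemisphere m)} {S T₁ T₂ : Hemisphere m} {v : ℂ}
    (hpos : 0 < S.val v) (hS : IsTop L v S) (h₁ : IsTop L v T₁) (h₂ : IsTop L v T₂)
    (h : S.agree T₁ ∩ S.agree T₂ = {v}) : Remains L S v :=
  remains_of_isTop hS h₁ h₂ (Hemisphere.touch_of_val_eq hpos (hS.val_eq h₁))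
    (Hemisphere.touch_of_val_eq hpos (hS.val_eq h₂)) h

/-- Two hemispheres whose boundary circles cross at a point touch one another. -/
theorem Hemisphere.touch_of_boundary {S T : Hemisphere m} {v : ℂ} (hS : S.val v = 0)
    (hT : T.val v = 0)
    (h : inner ℝ (T.center - S.center) (Complex.I * (v - S.center)) ≠ 0) : S.Touch T := by
  set u := T.center - S.center with hu
  set g := inner ℝ u (Complex.I * (v - S.center)) with hg
  have hu0 : u ≠ 0 := by rintro h0; rw [hg, h0, inner_zero_left] at h; exact h rfl
  have hun : 0 < ‖u‖ ^ 2 := pow_pos (norm_pos_iff.2 hu0) 2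
  have hperp : inner ℝ u (Complex.I * u) = 0 := by
    simp [Complex.inner]; ring
  have hin : inner ℝ (S.center - v) (Complex.I * u) = g := by
    rw [hg]; simp [Complex.inner]; ring
  have hS' := S.val_smul v (Complex.I * u) (g / ‖u‖ ^ 2)
  have hST := S.val_sub_val_smul T v (Complex.I * u) (g / ‖u‖ ^ 2)
  rw [← hu, hperp, hS, hT] at hST
  rw [hin, hS, norm_mul, Complex.norm_I, one_mul] at hS'
  have h1 : 0 + 2 * (g / ‖u‖ ^ 2) * g - (g / ‖u‖ ^ 2) ^ 2 * ‖u‖ ^ 2 = g ^ 2 / ‖u‖ ^ 2 := by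
    field_simp; ring
  rw [h1] at hS'
  refine touch_of_val_eq (z := v + (g / ‖u‖ ^ 2) • (Complex.I * u)) ?_ (by linarith)
  rw [hS']
  have : 0 < g ^ 2 := by positivity
  positivity

/-- At a boundary point of `S` where `S` is on top of a collection, another hemisphere on top rises
above `S` in each of the two directions tangent to the boundary circle. -/
theorem IsCollection.exists_isTop_inner_pos {L : List (Hemisphere m)}
    (hL : IsCollection L) {v τ : ℂ} {S : Hemisphere m} (hS : IsTop L v S) (hv : S.val v = 0)
    (hτ : τ ≠ 0) (hperp : inner ℝ (S.center - v) τ = 0) :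
    ∃ T, IsTop L v T ∧ 0 < inner ℝ (T.center - S.center) τ := by
  have hne := hL.nonempty
  have hlim : Filter.Tendsto (fun t : ℝ => v + t • τ) (nhdsWithin 0 (Set.Ioi 0)) (nhds v) := by
    have h : Continuous fun t : ℝ => v + t • τ := by fun_prop
    have h0 := h.tendsto 0
    rw [zero_smul, add_zero] at h0
    exact h0.mono_left nhdsWithin_le_nhds
  obtain ⟨t, ht, htop⟩ := (eventually_mem_nhdsWithin.and
    (hlim.eventually (eventually_isTop hne v))).exists
  have ht0 : 0 < t := ht
  obtain ⟨T, hT⟩ := exists_isTop hne (v + t • τ)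
  refine ⟨T, htop T hT, ?_⟩
  have h1 := hL.val_nonneg hT
  have h2 := S.val_smul v τ t
  have h3 := S.val_sub_val_smul T v τ t
  rw [hperp, hv] at h2
  rw [(htop T hT).val_eq hS] at h3
  have h4 : 0 < t ^ 2 * ‖τ‖ ^ 2 := by positivity
  have h5 : 0 < t * inner ℝ (T.center - S.center) τ := by linarith
  exact (mul_pos_iff_of_pos_left ht0).1 h5

/-- Inner products with two parallel vectors `a`, `b` of the plane are proportional. -/
theorem inner_mul_inner_eq_of_parallel (a b y τ : ℂ) (h : inner ℝ a (Complex.I * b) = 0) :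
    inner ℝ a y * inner ℝ b τ = inner ℝ b y * inner ℝ a τ := by
  simp only [Complex.inner, Complex.mul_re, Complex.conj_re, Complex.conj_im, Complex.mul_im,
      Complex.I_re, Complex.I_im] at h ⊢
  linear_combination (y.im * τ.re - y.re * τ.im) * h

/-- A hemisphere of a collection that is on top over a nonempty open set has a vertex. The vertex
may be a singular point: there are cells all of whose vertices are singular, as for `m = 21`. -/
theorem IsCollection.exists_remains {L : List (Hemisphere m)} (hL : IsCollection L)
    {S : Hemisphere m} (hint : (interior {z | IsTop L z S}).Nonempty) : ∃ v, Remains L S v := by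
  set C := {z | IsTop L z S} with hC
  have hCc : IsCompact C := by
    refine Metric.isCompact_of_isClosed_isBounded (isClosed_setOf_isTop L S) ?_
    refine Metric.isBounded_closedBall.subset (t := Metric.closedBall S.center 1) fun z hz => ?_
    rw [mem_closedBall_iff_norm]
    exact Hemisphere.norm_sub_center_le (hL.val_nonneg hz)
  obtain ⟨v, hv⟩ := hCc.extremePoints_nonempty (hint.mono interior_subset)
  have hS : IsTop L v S := hv.1
  refine ⟨v, ?_⟩
  rcases (hL.val_nonneg hS).lt_or_eq with hpos | hzero
  · by_contra hrem
    obtain ⟨d, hd, -, hev⟩ := hS.exists_eventually_isTop fun ⟨T₁, T₂, h₁, h₂, h⟩ =>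
      hrem (remains_of_isTop_of_val_pos hpos hS h₁ h₂ h)
    exact not_mem_extremePoints hd hev hv
  · have hv0 := hzero.symm
    set τ := Complex.I * (v - S.center) with hτ
    have hτ0 : τ ≠ 0 := by
      refine mul_ne_zero Complex.I_ne_zero fun h => ?_
      rw [Hemisphere.val, h, norm_zero] at hv0
      have := S.radius_pos
      nlinarith
    have hperp : inner ℝ (S.center - v) τ = 0 := by
      rw [hτ]; simp [Complex.inner]; ring
    obtain ⟨T₁, h₁, hp₁⟩ := hL.exists_isTop_inner_pos hS hv0 hτ0 hperp
    obtain ⟨T₂, h₂, hp₂⟩ := hL.exists_isTop_inner_pos hS hv0 (neg_ne_zero.2 hτ0)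
      (by rw [inner_neg_right, hperp, neg_zero])
    rw [inner_neg_right, neg_pos] at hp₂
    refine remains_of_isTop hS h₁ h₂
      (Hemisphere.touch_of_boundary hv0 ((h₁.val_eq hS).trans hv0) hp₁.ne')
      (Hemisphere.touch_of_boundary hv0 ((h₂.val_eq hS).trans hv0) hp₂.ne)
      (Hemisphere.agree_inter_eq_singleton (h₁.val_eq hS) (h₂.val_eq hS) fun hdet => ?_)
    -- If the centres were collinear, then the cell would be contained in a line.
    have hline : ∀ z ∈ C, inner ℝ (T₁.center - S.center) (z - v) = 0 := by
      intro z hz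
      have hle : ∀ T, IsTop L v T → inner ℝ (T.center - S.center) (z - v) ≤ 0 := by
        intro T hT
        have h3 := S.val_sub_val_smul T v (z - v) 1
        rw [one_smul, add_sub_cancel, hT.val_eq hS] at h3
        have h4 := (show IsTop L z S from hz).2 T hT.1
        linarith
      have h5 := inner_mul_inner_eq_of_parallel _ _ (z - v) τ hdet
      have h6 := hle T₁ h₁
      have h7 := hle T₂ h₂
      nlinarith
    obtain ⟨z, hz⟩ := hint
    have hlim : Filter.Tendsto (fun t : ℝ => z + t • τ) (nhdsWithin 0 (Set.Ioi 0)) (nhds z) := by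
      have h : Continuous fun t : ℝ => z + t • τ := by fun_prop
      have h0 := h.tendsto 0
      rw [zero_smul, add_zero] at h0
      exact h0.mono_left nhdsWithin_le_nhds
    obtain ⟨t, ht, htC⟩ := (eventually_mem_nhdsWithin.and
      (hlim.eventually (mem_interior_iff_mem_nhds.1 hz))).exists
    have h8 := hline _ htC
    rw [show z + t • τ - v = (z - v) + t • τ by ring, inner_add_right,
      hline z (interior_subset hz), inner_smul_right, zero_add] at h8
    exact (mul_pos (show 0 < t from ht) hp₁).ne' h8

theorem mem_erase_iff {L : List (Hemisphere m)} {S : Hemisphere m} :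
    S ∈ erase L ↔ S ∈ L ∧ ∃ z, Remains L S z := by
  simp [erase]

/-- Erasing the hemispheres without vertices does not change the upper envelope of a collection. -/
theorem IsCollection.exists_erase_val_ge {L : List (Hemisphere m)}
    (hL : IsCollection L) (z : ℂ) {T : Hemisphere m} (hT : T ∈ translates L) :
    ∃ T' ∈ translates (erase L), T.val z ≤ T'.val z := by
  have := Hemisphere.countable_hemisphere m
  have hne := hL.nonempty
  -- By Baire's theorem, the cells with interior points are dense, hence they cover the plane.
  have hdense := dense_iUnion_interior_of_closed (isClosed_setOf_isTop L)
    (Set.iUnion_eq_univ_iff.2 fun w => exists_isTop hne w)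
  obtain ⟨w, hw, htop⟩ := (mem_closure_iff_frequently.1 (hdense z)).and_eventually
    (eventually_isTop hne z) |>.exists
  obtain ⟨S, hS⟩ := Set.mem_iUnion.1 hw
  have hSz : IsTop L z S := htop S (interior_subset hS : w ∈ {z | IsTop L z S})
  obtain ⟨v, hv⟩ := hL.exists_remains ⟨w, hS⟩
  obtain ⟨S₀, hS₀, γ, hγ⟩ := hSz.1
  exact ⟨S, ⟨S₀, mem_erase_iff.2 ⟨hS₀, _, hv.of_center_eq hγ⟩, γ, hγ⟩, hSz.2 T hT⟩

theorem sqrt_val_mem_vertexHeights {L : List (Hemisphere m)} {S : Hemisphere m} {v : ℂ}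
    (hS : S ∈ translates L) (hv : Remains L S v) (hpos : 0 < S.val v) :
    √(S.val v) ∈ vertexHeights L := by
  obtain ⟨S₀, hS₀, γ, hγ⟩ := hS
  refine ⟨Real.sqrt_pos.2 hpos, S₀, hS₀, _, hv.of_center_eq hγ, Hemisphere.mem_surface_iff.2
    ⟨Real.sqrt_pos.2 hpos, ?_⟩⟩
  show S₀.val (v - toC γ) = √(S.val v) ^ 2
  rw [Real.sq_sqrt hpos.le, ← Hemisphere.val_add_eq hγ, sub_add_cancel]

/-- A collection containing the unit hemisphere at the origin has a vertex of positive height, on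
the line where this hemisphere agrees with its translate by `1`. The end of the segment on this
line is not on the unit circle, since the sixth roots of unity are not in `K`. -/
theorem IsCollection.nonempty_vertexHeights (hm : Squarefree m) (hm3 : m ≠ 3)
    {L : List (Hemisphere m)} (hL : IsCollection L) {S : Hemisphere m} (hS : S ∈ translates L)
    (hc : S.center = 0) (hr : S.radius = 1) : (vertexHeights L).Nonempty := by
  let pt : ℝ → ℂ := fun t => 1 / 2 + t * Complex.I
  have hpt : Continuous pt := by fun_prop
  have hval : ∀ t, S.val (pt t) = 3 / 4 - t ^ 2 := by
    intro t
    rw [Hemisphere.val, hc, hr, sub_zero, ← Complex.normSq_eq_norm_sq, Complex.normSq_apply]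
    simp [pt]; ring
  set A := {t : ℝ | IsTop L (pt t) S} with hA
  have hAc : IsCompact A := by
    refine Metric.isCompact_of_isClosed_isBounded ((isClosed_setOf_isTop L S).preimage hpt) ?_
    refine (Metric.isBounded_Icc (-1 : ℝ) 1).subset fun t ht => ?_
    have h1 := hL.val_nonneg (show IsTop L (pt t) S from ht)
    rw [hval] at h1
    constructor <;> nlinarith
  have h0 : (0 : ℝ) ∈ A := by
    refine ⟨hS, fun T hT => ?_⟩
    rw [hval]
    have h3 := T.radius_mul_norm_mu
    have h4 : T.radius ^ 2 * ‖toC T.mu‖ ^ 2 = 1 := by rw [← mul_pow, h3, one_pow]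
    rcases T.one_le_norm_mu.lt_or_eq with h | h
    · have h1 := norm_sq_add_one_le (a := (1 : 𝓞 (QuadField m))) (b := T.mu)
        (by rw [toC_one, norm_one]; exact h)
      rw [toC_one, norm_one] at h1
      have h2 := T.val_le_radius_sq (pt 0)
      nlinarith [sq_nonneg T.radius]
    · -- The centre is a lattice point, hence at distance at least `1 / 2` from `1 / 2`.
      have hne : T.mu - 2 * T.lam ≠ 0 := by
        intro h1
        have h2 : toC T.mu = 2 * toC T.lam := by
          rw [sub_eq_zero.1 h1, two_mul, toC_add, two_mul]
        rcases eq_or_ne T.lam 0 with h5 | h5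
        · exact T.toC_mu_ne_zero (by rw [h2, h5, toC_zero, mul_zero])
        · have h6 := one_le_norm_toC h5
          rw [h2, norm_mul, Complex.norm_ofNat] at h
          linarith
      have h1 := one_le_norm_toC hne
      have h2 : toC (T.mu - 2 * T.lam) = 2 * (toC T.mu * pt 0 - toC T.lam) := by
        rw [toC_sub, two_mul T.lam, toC_add]; simp only [pt, Complex.ofReal_zero]; ring
      rw [h2, norm_mul, T.norm_mul_sub, ← h, one_mul, Complex.norm_ofNat] at h1
      rw [← h] at h4
      unfold Hemisphere.val
      nlinarith
  obtain ⟨t₁, ht₁, hmax⟩ := hAc.exists_isGreatest ⟨0, h0⟩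
  have hStop : IsTop L (pt t₁) S := ht₁
  have hpos : 0 < S.val (pt t₁) := by
    refine (hL.val_nonneg hStop).lt_of_ne fun hz => ?_
    have hK : pt t₁ ∉ QuadField m := by
      refine notMem_quadField_of_norm_eq_one hm hm3 (by simp [pt]) ?_
      rw [Hemisphere.val, hc, hr, sub_zero] at hz
      exact (pow_left_inj₀ (norm_nonneg _) zero_le_one two_ne_zero).1 (by linarith)
    exact (hL.val_pos (fun h => hK h.mem_quadField) hStop).ne hz
  refine ⟨_, sqrt_val_mem_vertexHeights hS (v := pt t₁) ?_ hpos⟩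
  by_contra hrem
  obtain ⟨d, hd, hperp, hev⟩ := hStop.exists_eventually_isTop fun ⟨T₁, T₂, h₁, h₂, h⟩ =>
    hrem (remains_of_isTop_of_val_pos hpos hStop h₁ h₂ h)
  have hshift : (S.shift 1).val (pt t₁) = S.val (pt t₁) := by
    rw [hval, Hemisphere.val, Hemisphere.center_shift,
      Hemisphere.radius_eq_of_center_eq (S.center_shift 1), hc, hr, toC_one,
      ← Complex.normSq_eq_norm_sq, Complex.normSq_apply]
    simp [pt]; ring
  have hre := hperp (S.shift 1)
    ⟨shift_mem_translates hS 1, fun T hT => (hStop.2 T hT).trans hshift.ge⟩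
  rw [Hemisphere.center_shift, add_sub_cancel_left, toC_one] at hre
  have hre' : d.re = 0 := by simpa [Complex.inner] using hre
  have him : d.im ≠ 0 := fun h => hd (Complex.ext hre' h)
  have hlim : Filter.Tendsto (fun s : ℝ => s * d.im) (nhdsWithin 0 (Set.Ioi 0)) (nhds 0) := by
    have h : Continuous fun s : ℝ => s * d.im := by fun_prop
    have h' := h.tendsto 0
    rw [zero_mul] at h'
    exact h'.mono_left nhdsWithin_le_nhds
  obtain ⟨s, hs, htop⟩ := (eventually_mem_nhdsWithin.and (hlim.eventually hev)).exists
  have hmem : t₁ + s * d.im * d.im ∈ A := by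
    have h1 : pt (t₁ + s * d.im * d.im) = pt t₁ + (s * d.im) • d := by
      apply Complex.ext
      · simp [pt, hre']
      · simp [pt]
    show IsTop L _ S
    rw [h1]
    exact htop
  have h2 := hmax hmem
  have h3 : 0 < s * (d.im * d.im) := mul_pos hs (mul_self_pos.2 him)
  linarith

/-- The termination criterion: if every vertex of positive height of a collection is at least as
high as `1 / N`, then no hemisphere with `|μ| ≥ N` rises above the envelope. The argument looks at
an extreme point of the set where the difference of the squared heights is maximal. -/
theorem IsCollection.exists_val_ge {L : List (Hemisphere m)} (hL : IsCollection L)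
    {N : ℝ} (hN : 0 < N) (hheight : ∀ ζ ∈ vertexHeights L, 1 / N ≤ ζ) {S : Hemisphere m}
    (hS : N ≤ ‖toC S.mu‖) (z : ℂ) :
    ∃ T ∈ translates L, S.val z ≤ T.val z := by
  by_contra! hlt
  have hne := hL.nonempty
  set P : Set (ℂ × ℝ) := {p | 0 ≤ p.2 ∧ ∀ T ∈ translates L, T.val p.1 + p.2 ≤ S.val p.1} with hP
  have hPclosed : IsClosed P := by
    have : P = {p | 0 ≤ p.2} ∩ ⋂ T ∈ translates L, {p | T.val p.1 + p.2 ≤ S.val p.1} := by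
      ext p; simp [hP]
    rw [this]
    refine (isClosed_le continuous_const continuous_snd).inter (isClosed_biInter fun T _ => ?_)
    exact isClosed_le ((T.continuous_val.comp continuous_fst).add continuous_snd)
      (S.continuous_val.comp continuous_fst)
  have hPbound : ∀ p ∈ P, ‖p.1 - S.center‖ ≤ 1 ∧ p.2 ≤ 1 := by
    rintro p ⟨h0, h1⟩
    obtain ⟨T, hT⟩ := exists_isTop hne p.1
    have h2 := hL.val_nonneg hT
    have h3 := h1 T hT.1
    exact ⟨Hemisphere.norm_sub_center_le (by linarith), by linarith [S.val_le_one p.1]⟩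
  have hPc : IsCompact P := by
    refine Metric.isCompact_of_isClosed_isBounded hPclosed ?_
    refine ((Metric.isBounded_closedBall (x := S.center) (r := 1)).prod
      (Metric.isBounded_Icc (0 : ℝ) 1)).subset fun p hp => ?_
    exact ⟨mem_closedBall_iff_norm.2 (hPbound p hp).1, hp.1, (hPbound p hp).2⟩
  have hmemP : ∀ w T, IsTop L w T → 0 ≤ S.val w - T.val w → (w, S.val w - T.val w) ∈ P := by
    intro w T hT h
    refine ⟨h, fun T' hT' => ?_⟩
    have := hT.2 T' hT'
    show T'.val w + (S.val w - T.val w) ≤ S.val w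
    linarith
  obtain ⟨T₁, hT₁⟩ := exists_isTop hne z
  have hz1 := sub_pos.2 (hlt T₁ hT₁.1)
  obtain ⟨⟨z₂, h₂⟩, hp₂, hmax⟩ := hPc.exists_isMaxOn ⟨_, hmemP z T₁ hT₁ hz1.le⟩
    continuous_snd.continuousOn
  have hmax' : ∀ w T, IsTop L w T → S.val w - T.val w ≤ h₂ := by
    intro w T hT
    rcases le_total 0 (S.val w - T.val w) with h | h
    · exact hmax (hmemP w T hT h)
    · exact h.trans hp₂.1
  have hh₂ : 0 < h₂ := hz1.trans_le (hmax' z T₁ hT₁)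
  set M : Set ℂ := {w | (w, h₂) ∈ P} with hM
  have hMc : IsCompact M := by
    refine Metric.isCompact_of_isClosed_isBounded
      (hPclosed.preimage (Continuous.prodMk_left h₂)) ?_
    exact (Metric.isBounded_closedBall (x := S.center) (r := 1)).subset fun w hw =>
      mem_closedBall_iff_norm.2 (hPbound _ hw).1
  obtain ⟨v, hv⟩ := hMc.extremePoints_nonempty ⟨z₂, hp₂⟩
  have hvP : (v, h₂) ∈ P := hv.1
  obtain ⟨T, hT⟩ := exists_isTop hne v
  have hTv : S.val v - T.val v = h₂ := le_antisymm (hmax' v T hT) (by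
    have : T.val v + h₂ ≤ S.val v := hvP.2 T hT.1
    linarith)
  have hSv : 0 < S.val v := by linarith [hL.val_nonneg hT]
  have hTpos : 0 < T.val v := hL.val_pos (fun h => (h.val_le S).not_gt hSv) hT
  by_cases hvert : ∃ T₁ T₂, IsTop L v T₁ ∧ IsTop L v T₂ ∧ T.agree T₁ ∩ T.agree T₂ = {v}
  · obtain ⟨T₁, T₂, h3, h4, h5⟩ := hvert
    have h6 := hheight _ (sqrt_val_mem_vertexHeights hT.1
      (remains_of_isTop_of_val_pos hTpos hT h3 h4 h5) hTpos)
    have h7 : (1 / N) ^ 2 ≤ T.val v := by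
      rw [← Real.sq_sqrt hTpos.le]
      exact pow_le_pow_left₀ (by positivity) h6 2
    have h8 : S.radius ≤ 1 / N := one_div_le_one_div_of_le hN hS
    have h9 := pow_le_pow_left₀ S.radius_pos.le h8 2
    linarith [S.val_le_radius_sq v]
  · obtain ⟨d, hd, -, hev⟩ := hT.exists_eventually_isTop hvert
    refine not_mem_extremePoints hd ?_ hv
    have hev' : ∀ᶠ t in nhds (0 : ℝ), IsTop L (v + (-t) • d) T := by
      have h : Filter.Tendsto (fun t : ℝ => -t) (nhds 0) (nhds 0) := by
        simpa using (continuous_neg (G := ℝ)).tendsto 0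
      exact h.eventually hev
    filter_upwards [hev, hev'] with t ht ht'
    have h3 := T.val_sub_val_smul S v d t
    have h4 := T.val_sub_val_smul S v d (-t)
    have h5 := hmax' _ T ht
    have h6 := hmax' _ T ht'
    have h7 : S.val (v + t • d) - T.val (v + t • d) = h₂ := by linarith
    have h8 := hmemP _ T ht (by rw [h7]; exact hh₂.le)
    rwa [h7] at h8

/-! ### The algorithm -/

theorem Hemisphere.EverywhereBelow.refl (S : Hemisphere m) : S.EverywhereBelow S := by
  simp [EverywhereBelow]

theorem mem_recordOne_of_mem {L : List (Hemisphere m)} {S T : Hemisphere m} (h : T ∈ L) :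
    T ∈ recordOne L S := by
  unfold recordOne
  split_ifs
  · exact h
  · exact List.mem_append_left _ h

theorem exists_everywhereBelow_recordOne (L : List (Hemisphere m)) (S : Hemisphere m) :
    ∃ T ∈ recordOne L S, S.EverywhereBelow T := by
  unfold recordOne
  split_ifs with h
  · exact h
  · exact ⟨S, by simp, .refl S⟩

theorem mem_foldl_recordOne_of_mem {order L : List (Hemisphere m)} {T : Hemisphere m}
    (h : T ∈ L) : T ∈ order.foldl recordOne L := by
  induction order generalizing L with
  | nil => exact h
  | cons S order ih => exact ih (mem_recordOne_of_mem h)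

theorem exists_everywhereBelow_foldl {order L : List (Hemisphere m)} {S : Hemisphere m}
    (h : S ∈ order) : ∃ T ∈ order.foldl recordOne L, S.EverywhereBelow T := by
  induction order generalizing L with
  | nil => exact absurd h List.not_mem_nil
  | cons S' order ih =>
    rcases List.mem_cons.1 h with rfl | h
    · obtain ⟨T, hT, hST⟩ := exists_everywhereBelow_recordOne L S
      exact ⟨T, mem_foldl_recordOne_of_mem (order := order) hT, hST⟩
    · exact ih h

/-- The invariant of the algorithm: the hemispheres with `|μ| < N` do not rise above the envelope of
the list. Moreover, `N` is a value of `μ ↦ |μ|`, and it exceeds `1` once the list is nonempty. -/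
structure Recorded (s : State m) : Prop where
  val_le : ∀ S : Hemisphere m, ‖toC S.mu‖ < s.N → ∀ z, 0 < S.val z →
    ∃ T ∈ translates s.list, S.val z ≤ T.val z
  one_lt : s.list ≠ [] → 1 < s.N
  isNorm : ∃ μ : 𝓞 (QuadField m), μ ≠ 0 ∧ ‖toC μ‖ = s.N

theorem recorded_initialState (m : ℕ) : Recorded (initialState m) where
  val_le S hS := absurd S.one_le_norm_mu hS.not_ge
  one_lt h := absurd rfl h
  isNorm := ⟨1, one_ne_zero, by rw [toC_one, norm_one]; rfl⟩

theorem isCollection_of_not_keepRecording {s : State m} (h : ¬ KeepRecording s) :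
    IsCollection s.list := by
  by_contra hc
  exact h (Or.inr hc)

theorem IsCollection.ne_nil {L : List (Hemisphere m)} (hL : IsCollection L) : L ≠ [] := by
  rintro rfl
  obtain ⟨S, T, hT, -⟩ := hL.nonempty
  exact List.not_mem_nil hT

theorem Recorded.one_lt_of_not_keepRecording {s : State m} (hs : Recorded s)
    (h : ¬ KeepRecording s) : 1 < s.N :=
  hs.one_lt (isCollection_of_not_keepRecording h).ne_nil

theorem Recorded.erase {s : State m} (hs : Recorded s) (h : ¬ KeepRecording s) (E : ℝ) (b : Bool) :
    Recorded ⟨s.N, E, erase s.list, b⟩ where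
  val_le S hS z hz := by
    obtain ⟨T, hT, h1⟩ := hs.val_le S hS z hz
    obtain ⟨T', hT', h2⟩ := (isCollection_of_not_keepRecording h).exists_erase_val_ge z hT
    exact ⟨T', hT', h1.trans h2⟩
  one_lt _ := hs.one_lt_of_not_keepRecording h
  isNorm := hs.isNorm

theorem Recorded.step (hm : m ≠ 0) {s t : State m} (hs : Recorded s) (h : Step m s t) :
    Recorded t := by
  cases h with
  | record order N' running cond complete next =>
    obtain ⟨⟨hlt, μ', hμ'⟩, hmin⟩ := next
    obtain ⟨μ, hμ0, hμ⟩ := hs.isNorm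
    have hone : 1 < N' := ((one_le_norm_toC hμ0).trans_eq hμ).trans_lt hlt
    have hμ0' : μ' ≠ 0 := by
      rintro rfl
      rw [toC_zero, norm_zero] at hμ'
      linarith
    refine ⟨fun S hS z hz => ?_, fun _ => hone, μ', hμ0', hμ'⟩
    have hle : ‖toC S.mu‖ ≤ s.N := by
      by_contra! hgt
      exact (hmin ⟨hgt, _, rfl⟩).not_gt hS
    rcases hle.lt_or_eq with hlt' | heq
    · obtain ⟨T, hT, h1⟩ := hs.val_le S hlt' z hz
      exact ⟨T, translates_mono (fun _ => mem_foldl_recordOne_of_mem) hT, h1⟩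
    · obtain ⟨γ, hγ⟩ := exists_sub_mem_D0 hm S.center
      have hc := S.center_eq_shift_neg_add γ
      have hcand : S.shift (-γ) ∈ candidates m s.N := by
        refine ⟨heq, ?_⟩
        rwa [Hemisphere.center_shift, toC_neg, ← sub_eq_add_neg]
      obtain ⟨T, hT, hbelow⟩ := exists_everywhereBelow_foldl (L := s.list)
        ((complete _).2 hcand)
      have hval : (S.shift (-γ)).val (z - toC γ) = S.val z := by
        rw [← Hemisphere.val_add_eq hc, sub_add_cancel]
      refine ⟨T.shift γ, shift_mem_translates (mem_translates_of_mem hT) γ, ?_⟩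
      have h1 := hbelow.val_le (z := z - toC γ) (by rw [hval]; exact hz.le)
      rwa [hval, ← T.val_shift γ, sub_add_cancel] at h1
  | stop_test ζ running cond lowest test => exact hs.erase cond _ _
  | continue_test ζ running cond lowest test => exact hs.erase cond _ _

theorem Step.running {s t : State m} (h : Step m s t) : s.fulfilled = false := by
  cases h <;> assumption

theorem recorded_of_reachable (hm : m ≠ 0) {s : State m} (h : Reachable m s) : Recorded s := by
  induction h with
  | refl => exact recorded_initialState m
  | tail _ hstep ih => exact ih.step hm hstep

/-- The unit hemisphere at the origin is never lost. -/
theorem Recorded.exists_unit {s : State m} (hs : Recorded s) (hN : 1 < s.N) :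
    ∃ S ∈ translates s.list, S.center = 0 ∧ S.radius = 1 := by
  let S₀ : Hemisphere m := ⟨1, 0, one_ne_zero, unimodular_of_isCoprime isCoprime_one_left⟩
  have hval : S₀.val 0 = 1 := by
    simp [S₀, Hemisphere.val, Hemisphere.center, Hemisphere.radius, toC_one, toC_zero]
  obtain ⟨T, hT, h⟩ := hs.val_le S₀ (by rwa [show S₀.mu = 1 from rfl, toC_one, norm_one]) 0
    (by rw [hval]; exact one_pos)
  rw [hval, Hemisphere.val, zero_sub, norm_neg] at h
  have h1 := T.radius_le_one
  have h2 := T.radius_pos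
  have h3 : T.radius = 1 := by nlinarith [sq_nonneg ‖T.center‖]
  refine ⟨T, hT, ?_, h3⟩
  rw [h3] at h
  exact norm_eq_zero.1 (pow_eq_zero_iff two_ne_zero |>.1
    (le_antisymm (by linarith) (sq_nonneg ‖T.center‖)))

theorem Recorded.exists_step (hm : Squarefree m) (hm3 : m ≠ 3) {s : State m} (hs : Recorded s)
    (hrun : s.fulfilled = false) : ∃ t, Step m s t := by
  by_cases hk : KeepRecording s
  · obtain ⟨N', hN'⟩ := exists_isNextNorm m s.N
    exact ⟨_, Step.record s (finite_candidates m s.N).toFinset.toList N' hrun hk (by simp) hN'⟩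
  · obtain ⟨S, hS, hc, hr⟩ := hs.exists_unit (hs.one_lt_of_not_keepRecording hk)
    have hne := (isCollection_of_not_keepRecording hk).nonempty_vertexHeights hm hm3 hS hc hr
    obtain ⟨ζ, hζ, hmin⟩ := Set.exists_min_image _ id (finite_vertexHeights s.list) hne
    have hleast : IsLeast (vertexHeights s.list) ζ := ⟨hζ, hmin⟩
    rcases le_or_gt (1 / s.N) ζ with h | h
    · exact ⟨_, Step.stop_test s ζ hrun hk hleast h⟩
    · exact ⟨_, Step.continue_test s ζ hrun hk hleast h⟩

theorem mem_BList_iff {L : List (Hemisphere m)} {p : ℂ × ℝ} :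
    p ∈ BList L ↔ 0 < p.2 ∧ ∀ S ∈ translates L, S.val p.1 ≤ p.2 ^ 2 := by
  simp only [BList, upperHalfSpace, Set.mem_ofPred_eq, Hemisphere.one_le_level_iff]

theorem BList_eq_B_of_fulfilled (hm : m ≠ 0) {s : State m} (h : Reachable m s)
    (hs : s.fulfilled = true) : BList s.list = B m := by
  rcases Relation.ReflTransGen.cases_tail h with rfl | ⟨s₀, h₀, hstep⟩
  · exact absurd hs (by simp [initialState])
  have hrec := recorded_of_reachable hm h₀
  cases hstep with
  | record => exact absurd hs (by simp)
  | continue_test => exact absurd hs (by simp)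
  | stop_test ζ running cond lowest test =>
    have hcoll := isCollection_of_not_keepRecording cond
    have hN := hrec.one_lt_of_not_keepRecording cond
    have hdom : ∀ (S : Hemisphere m) (z : ℂ), 0 < S.val z →
        ∃ T ∈ translates (erase s₀.list), S.val z ≤ T.val z := by
      intro S z hz
      obtain ⟨T, hT, h1⟩ : ∃ T ∈ translates s₀.list, S.val z ≤ T.val z := by
        rcases lt_or_ge ‖toC S.mu‖ s₀.N with hlt | hge
        · exact hrec.val_le S hlt z hz
        · exact hcoll.exists_val_ge (by linarith) (fun ζ' h' => test.trans (lowest.2 h')) hge z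
      obtain ⟨T', hT', h2⟩ := hcoll.exists_erase_val_ge z hT
      exact ⟨T', hT', h1.trans h2⟩
    ext p
    rw [mem_BList_iff, mem_B_iff]
    refine and_congr_right fun _ => ⟨fun hp S => ?_, fun hp S _ => hp S⟩
    rcases le_or_gt (S.val p.1) 0 with h1 | h1
    · exact h1.trans (sq_nonneg _)
    · obtain ⟨T, hT, h2⟩ := hdom S p.1 h1
      exact h2.trans (hp T hT)

theorem Recorded.isCollection {s : State m} (hs : Recorded s) {R : ℝ}
    (hR : ∀ z, ¬ IsSingularPoint m z → DominatedAt m R z) (hN : R < s.N) :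
    IsCollection s.list := by
  intro z hz
  obtain ⟨S, h1, h2, -⟩ := hR z hz
  obtain ⟨T, hT, h3⟩ := hs.val_le S (h1.trans_lt hN) z h2
  exact ⟨T, hT, pointStrictlyBelow_iff.2 (h2.trans_le h3)⟩

/-- Once `N` is large, only finitely many hemispheres modulo translation are on top anywhere. -/
theorem Recorded.norm_mu_le {s : State m} (hs : Recorded s) {R : ℝ}
    (hR : ∀ z, ¬ IsSingularPoint m z → DominatedAt m R z) (hN : R < s.N) {z : ℂ}
    (hz : ¬ IsSingularPoint m z) {T : Hemisphere m} (hT : IsTop s.list z T) :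
    ‖toC T.mu‖ ≤ R := by
  obtain ⟨S, h1, h2, h3⟩ := hR z hz
  obtain ⟨T', hT', h4⟩ := hs.val_le S (h1.trans_lt hN) z h2
  by_contra! hlt
  exact (h4.trans (hT.2 T' hT')).not_gt (h3 T hlt)

theorem Recorded.le_of_mem_vertexHeights {s : State m} (hs : Recorded s) {R η : ℝ}
    (hR : ∀ z, ¬ IsSingularPoint m z → DominatedAt m R z) (hN : R < s.N)
    (hη : ∀ (S T₁ T₂ : Hemisphere m) (z : ℂ) (ζ : ℝ), ‖toC S.mu‖ ≤ R → ‖toC T₁.mu‖ ≤ R →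
      ‖toC T₂.mu‖ ≤ R → S.IsVertex T₁ T₂ z → 0 < ζ → S.val z = ζ ^ 2 → η ≤ ζ)
    {ζ : ℝ} (hζ : ζ ∈ vertexHeights s.list) : η ≤ ζ := by
  obtain ⟨h0, S, hS, z, hrem, hmem⟩ := hζ
  rw [Hemisphere.mem_surface_iff] at hmem
  rw [remains_iff] at hrem
  obtain ⟨⟨T₁, h₁, T₂, h₂, hv⟩, hmax⟩ := hrem
  have hval : S.val z = ζ ^ 2 := hmem.2
  have hsing : ¬ IsSingularPoint m z := fun h => by
    have := h.val_le S
    rw [hval] at this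
    exact this.not_gt (pow_pos h0 2)
  have hzv : z ∈ S.agree T₁ ∩ S.agree T₂ := by rw [hv.2.2]; rfl
  have e₁ := Hemisphere.mem_agree_iff.1 hzv.1
  have e₂ := Hemisphere.mem_agree_iff.1 hzv.2
  have hle : ∀ T ∈ translates s.list, S.val z = T.val z → ‖toC T.mu‖ ≤ R := fun T hT he =>
    hs.norm_mu_le hR hN hsing ⟨hT, fun T' hT' => (hmax T' hT').trans he.le⟩
  exact hη S T₁ T₂ z ζ (hle S (mem_translates_of_mem hS) rfl) (hle T₁ h₁ e₁) (hle T₂ h₂ e₂) hv h0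
    hval

/-- In an infinite run, `N` exceeds every bound, since a failed test is followed by a pass through
the inner loop. -/
theorem exists_lt_N {run : ℕ → State m} (hrec : ∀ k, Recorded (run k))
    (hstep : ∀ k, Step m (run k) (run (k + 1))) :
    Monotone (fun k => (run k).N) ∧ ∀ b : ℝ, ∃ k, b < (run k).N := by
  have hrun : ∀ k, (run k).fulfilled = false := fun k => (hstep k).running
  have hrecord : ∀ k, KeepRecording (run k) → (run k).N < (run (k + 1)).N := by
    intro k hk
    have h := hstep k
    generalize run (k + 1) = t at h
    cases h with
    | record order N' running cond complete next => exact next.1.1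
    | stop_test ζ running cond lowest test => exact absurd hk cond
    | continue_test ζ running cond lowest test => exact absurd hk cond
  have htest : ∀ k, ¬ KeepRecording (run k) →
      (run (k + 1)).N = (run k).N ∧ KeepRecording (run (k + 1)) := by
    intro k hk
    have h := hstep k
    have hr := hrun (k + 1)
    have hN := (hrec k).one_lt_of_not_keepRecording hk
    generalize run (k + 1) = t at h hr
    cases h with
    | record order N' running cond complete next => exact absurd cond hk
    | stop_test ζ running cond lowest test => exact absurd hr (by simp)
    | continue_test ζ running cond lowest test =>
      refine ⟨rfl, Or.inl ?_⟩
      have h0 : 0 < ζ := lowest.1.1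
      exact ((lt_one_div (by linarith) h0).2 test).le
  have hmono : Monotone (fun k => (run k).N) := monotone_nat_of_le_succ fun k => by
    by_cases hk : KeepRecording (run k)
    · exact (hrecord k hk).le
    · exact (htest k hk).1.ge
  refine ⟨hmono, fun b => ?_⟩
  have htwo : StrictMono fun k => (run (2 * k)).N := strictMono_nat_of_lt_succ fun k => by
    show (run (2 * k)).N < (run (2 * k + 1 + 1)).N
    by_cases hk : KeepRecording (run (2 * k))
    · exact (hrecord _ hk).trans_le (hmono (Nat.le_succ _))
    · exact (htest _ hk).1.symm.trans_lt (hrecord _ (htest _ hk).2)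
  by_contra! hb
  refine Set.infinite_of_injective_forall_mem htwo.injective (fun k => ?_)
    ((finite_norm_le m b).image fun a => ‖toC a‖)
  obtain ⟨μ, -, hμ⟩ := (hrec (2 * k)).isNorm
  exact ⟨μ, hμ.trans_le (hb _), hμ⟩

theorem not_exists_run (hm : m ≠ 0) : ¬ ∃ run : ℕ → State m, run 0 = initialState m ∧
    ∀ k, Step m (run k) (run (k + 1)) := by
  rintro ⟨run, h0, hstep⟩
  have hrec : ∀ k, Recorded (run k) := fun k => by
    induction k with
    | zero => rw [h0]; exact recorded_initialState m
    | succ k ih => exact ih.step hm (hstep k)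
  obtain ⟨hmono, hunb⟩ := exists_lt_N hrec hstep
  obtain ⟨R, hR⟩ := exists_dominatedAt hm
  obtain ⟨η, hη0, hη⟩ := exists_le_height hm R
  obtain ⟨k₀, hk₀⟩ := hunb R
  have hlarge : ∀ k ≥ k₀, R < (run k).N := fun k hk => hk₀.trans_le (hmono hk)
  -- From this point on, the estimate `E` is bounded by the reciprocal of the lowest vertex height.
  have hE : ∀ k ≥ k₀, (run k).E ≤ max (run k₀).E (1 / η) := by
    intro k hk
    induction k, hk using Nat.le_induction with
    | base => exact le_max_left _ _
    | succ k hk ih =>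
      have h := hstep k
      generalize run (k + 1) = t at h
      cases h with
      | record => exact ih
      | stop_test => exact ih
      | continue_test ζ running cond lowest test =>
        exact (one_div_le_one_div_of_le hη0
          ((hrec k).le_of_mem_vertexHeights hR (hlarge k hk) hη lowest.1)).trans (le_max_right _ _)
  obtain ⟨k, hk⟩ := hunb (max (run k₀).N (max (run k₀).E (1 / η)))
  have hk₀k : k₀ ≤ k := by
    by_contra! h
    exact ((le_max_left _ _).trans_lt hk).not_ge (hmono h.le)
  have hNE := (le_max_right _ _).trans_lt hk
  have hNη : 1 / η < (run k).N := (le_max_right _ _).trans_lt hNE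
  have hnot : ¬ KeepRecording (run k) := by
    rintro (h | h)
    · exact (h.trans (hE k hk₀k)).not_gt hNE
    · exact h ((hrec k).isCollection hR (hlarge k hk₀k))
  have hnext : (run (k + 1)).fulfilled = false := (hstep (k + 1)).running
  have h := hstep k
  generalize run (k + 1) = t at h hnext
  cases h with
  | record order N' running cond complete next => exact hnot cond
  | stop_test ζ running cond lowest test => exact absurd hnext (by simp)
  | continue_test ζ running cond lowest test =>
    have h1 := (hrec k).le_of_mem_vertexHeights hR (hlarge k hk₀k) hη lowest.1
    have hN0 : 0 < (run k).N := lt_trans (by positivity) hNη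
    have h2 := (one_div_lt hη0 hN0).1 hNη
    linarith

end Bianchi

theorem mainTheorem3 (m : ℕ) (hm : Squarefree m) (hm1 : m ≠ 1) (hm3 : m ≠ 3) :
    (∀ r : ℝ, (Bianchi.candidates m r).Finite) ∧
    (∀ (L : List (Bianchi.Hemisphere m)) (S : Bianchi.Hemisphere m),
      {T | T ∈ Bianchi.translates L ∧ S.Touch T}.Finite ∧ {z | Bianchi.Remains L S z}.Finite) ∧
    (∀ s : Bianchi.State m, Bianchi.Reachable m s → s.fulfilled = false →
      ∃ t, Bianchi.Step m s t) ∧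
    (¬ ∃ run : ℕ → Bianchi.State m, run 0 = Bianchi.initialState m ∧
      ∀ k, Bianchi.Step m (run k) (run (k + 1))) ∧
    (∀ s : Bianchi.State m, Bianchi.Reachable m s → s.fulfilled = true →
      Bianchi.BList s.list = Bianchi.B m ∧
      Bianchi.BList s.list ∩ Bianchi.DInfty m = Bianchi.polyhedron m) := by
  have hm0 : m ≠ 0 := hm.ne_zero
  refine ⟨Bianchi.finite_candidates m, fun L S => ⟨Bianchi.finite_touch L S,
    Bianchi.finite_remains L S⟩, fun s hs hrun =>
    (Bianchi.recorded_of_reachable hm0 hs).exists_step hm hm3 hrun,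
    Bianchi.not_exists_run hm0, fun s hs hful => ?_⟩
  have h := Bianchi.BList_eq_B_of_fulfilled hm0 hs hful
  exact ⟨h, by rw [h, Set.inter_comm]; rfl⟩
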